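/- Let $F$ be a number field. Let $\boldsymbol\Sigma=(\Sigma,N,\beta)$ be a simplicial stacky fan: $N$ is a finitely generated abelian group with a fixed splitting $N=N^{\mathrm{rig}}\oplus N_{\mathrm{tor}}\cong\mathbb Z^d\times\prod_{i=1}^k\mathbb Z/\ell_i\mathbb Z$ ($\ell_i\ge 1$), $\Sigma$ is a complete simplicial rational fan in $N_{\mathbb R}=\mathbb R^d$, and $\beta:\mathbb Z^{\Sigma(1)}\to N$ is a homomorphism with finite cokernel such that, for every ray $\rho$, the image $b_\rho\in N^{\mathrm{rig}}$ of $\beta(e_\rho)$ is a non-zero element of $\rho$. The toric stack of $\boldsymbol\Sigma$ has the split stacky torus $\mathcal T=\mathbb G_m^d\times B\big(\prod_i\mu_{\ell_i}\big)$, with $$\mathcal T(F)=(F^\times)^d\times\prod_{i=1}^k F^\times/(F^\times)^{\ell_i}.$$ For $x\in N_{\mathbb R}$ let $x=\sum_{\rho\in\Sigma(1)}a_\rho(x)b_\rho$ be the unique expansion with all $a_\rho(x)\ge0$ and $a_\rho(x)=0$ for every ray $\rho$ outside $\sigma$, where $\sigma\in\Sigma$ is a cone containing $x$. For $y=(\mathbf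 y,g)\in N^{\mathrm{rig}}\times N_{\mathrm{tor}}$ put $a_\rho(y)=a_\rho(\mathbf y)$ and $q(y)=\big(\sum_\rho\{a_\rho(\mathbf y)\}b_\rho,\,g\big)$, where $\{\cdot\}$ is the fractional part. Let $\mathrm{Box}(\Sigma)$ be the set of all $y\in N^{\mathrm{rig}}\times N_{\mathrm{tor}}$ whose first component lies in a $d$-dimensional cone of $\Sigma$ and for which $a_\rho(y)<1$ for all $\rho$; its elements are the sectors of the stack, and the twisted sectors are the elements of $\Pi:=\mathrm{Box}(\Sigma)\setminus\{0\}$. On $\mathbb R^{\Sigma(1)\sqcup\Pi}$ define the linear forms $$\Xi_\rho(t)=t_\rho\quad(\rho\in\Sigma(1)),\qquad \Xi_{\mathcal Y}(t)=t_{\mathcal Y}+\sum_{\rho\in\Sigma(1)}a_\rho(\mathcal Y)\,t_\rho\quad(\mathcal Y\in\Pi),$$ the cone $\Lambda=\{t:\Xi_j(t)\ge0\text{ for all }j\in\Sigma(1)\sqcup\Pi\}$, and let $\Lambda^\circ$ be its relative interior (the set where all $\Xi_j(t)>0$). For $t\in\mathbb R^{\Sigma(1)\sqcup\Pi}$ let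 $\phi_t(y)=\sum_\rho a_\rho(y)t_\rho+t_{q(y)}$ on $N^{\mathrm{rig}}\times N_{\mathrm{tor}}$, where the last term is omitted if $q(y)=0$, and let $\phi_t^\infty(x)=\sum_\rho a_\rho(x)t_\rho$ on $N_{\mathbb R}$. For $x=((x_j)_j,(z_i)_i)\in\mathcal T(F)$ put $$H_t(x)=\prod_{v\nmid\infty}q_v^{\,\phi_t\left((\mathrm{ord}_v(x_j))_j,\,(\mathrm{ord}_v(z_i)\bmod \ell_i)_i\right)}\ \prod_{v\mid\infty}\exp\!\Big([F_v:\mathbb R]\,\phi^\infty_t\big((-\log|x_j|_v)_j\big)\Big),$$ where $q_v$ is the cardinality of the residue field at $v$ and $|\cdot|_v$ is the usual absolute value on $F_v=\mathbb R$ or $\mathbb C$. Then for every $t\in\Lambda^\circ$ there is a polynomial $P$ such that for every real $B\ge0$ the set $\{x\in\mathcal T(F):H_t(x)\le B\}$ is finite and $$\#\{x\in\mathcal T(F):H_t(x)\le B\}\le P(B).$$ -/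

import Mathlib

open NumberField IsDedekindDomain

noncomputable section

namespace ToricStack

/-! ### Split stacky tori -/

/-- The cocharacter group `X_*(𝒯) = N^rig × G^D = ℤ^d × ∏ i, ℤ/ℓ_i` of the split stacky torus
`𝒯 = 𝔾_m^d × B(∏ i, μ_{ℓ_i})`. -/
abbrev Cochar (d : ℕ) {k : ℕ} (ℓ : Fin k → ℕ) : Type :=
  (Fin d → ℤ) × (∀ i : Fin k, ZMod (ℓ i))

/-- `Bμ_n(K) = Kˣ / (Kˣ)^n`. -/
abbrev BMu (n : ℕ) (K : Type*) [Field K] : Type _ :=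
  Kˣ ⧸ (powMonoidHom n : Kˣ →* Kˣ).range

/-- The (isomorphism classes of) `K`-points of the split stacky torus `𝔾_m^d × B(∏ i, μ_{ℓ_i})`. -/
abbrev TorusPoints (d : ℕ) {k : ℕ} (ℓ : Fin k → ℕ) (K : Type*) [Field K] : Type _ :=
  (Fin d → Kˣ) × (∀ i : Fin k, BMu (ℓ i) K)

/-- The map `Bμ_n(K) → Bμ_n(L)` induced by a homomorphism of fields. -/
def BMu.map (n : ℕ) {K L : Type*} [Field K] [Field L] (f : K →+* L) : BMu n K →* BMu n L :=
  QuotientGroup.map _ _ (Units.map (f : K →* L)) (by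
    rintro _ ⟨x, rfl⟩
    exact ⟨Units.map (f : K →* L) x, by simp⟩)

/-- The map `𝒯(K) → 𝒯(L)` induced by a homomorphism of fields. -/
def TorusPoints.map {d k : ℕ} {ℓ : Fin k → ℕ} {K L : Type*} [Field K] [Field L] (f : K →+* L)
    (x : TorusPoints d ℓ K) : TorusPoints d ℓ L :=
  (fun i => Units.map (f : K →* L) (x.1 i), fun i => BMu.map (ℓ i) f (x.2 i))

/-! ### Simplicial stacky fans -/

/-- A simplicial fan in `ℝ^d`: a finite set of simplicial cones, closed under taking faces, any two
of which intersect in a common face. -/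
structure SimplicialFan (d : ℕ) where
  cones : Set (PointedCone ℝ (Fin d → ℝ))
  finite_cones : cones.Finite
  simplicial : ∀ σ ∈ cones, σ.IsSimplicial
  face_mem : ∀ σ ∈ cones, ∀ τ : PointedCone ℝ (Fin d → ℝ), τ.IsFaceOf σ → τ ∈ cones
  inter_face : ∀ σ ∈ cones, ∀ τ ∈ cones, (σ ⊓ τ).IsFaceOf σ

namespace SimplicialFan

variable {d : ℕ} (S : SimplicialFan d)

/-- The set `Σ(j)` of `j`-dimensional cones of the fan. -/
def conesOfDim (j : ℕ) : Set (PointedCone ℝ (Fin d → ℝ)) :=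
  {σ ∈ S.cones | Module.finrank ℝ (Submodule.span ℝ (σ : Set (Fin d → ℝ))) = j}

/-- The rays of the fan. -/
abbrev Ray : Type := S.conesOfDim 1

instance : Finite S.Ray := (S.finite_cones.subset (fun _ h => h.1)).to_subtype

instance : Fintype S.Ray := Fintype.ofFinite _

/-- The fan is complete: its cones cover the space. -/
def IsComplete : Prop := ∀ x : Fin d → ℝ, ∃ σ ∈ S.cones, x ∈ σ

end SimplicialFan

/-- A simplicial stacky fan `(Σ, N, β)`. The finitely generated abelian group `N` comes with a fixed
splitting `N ≃ N^rig × N_tor = ℤ^d × ∏ i, ℤ/ℓ_i`, by which `N_ℝ` is identified with `ℝ^d`;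
`β : ℤ^{Σ(1)} → N` has finite cokernel and `β(e_ρ)` spans the ray `ρ` (so that the rays, and
hence all cones of `Σ`, are rational). -/
structure StackyFan {N : Type*} [AddCommGroup N] {d k : ℕ} {ℓ : Fin k → ℕ}
    (e : N ≃+ Cochar d ℓ) extends SimplicialFan d where
  β : (toSimplicialFan.Ray →₀ ℤ) →+ N
  finiteIndex_range : β.range.FiniteIndex
  β_mem : ∀ ρ : toSimplicialFan.Ray,
    (fun i => (((e (β (Finsupp.single ρ 1))).1 i : ℤ) : ℝ)) ∈ ρ.1
  β_ne_zero : ∀ ρ : toSimplicialFan.Ray, (e (β (Finsupp.single ρ 1))).1 ≠ 0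

namespace StackyFan

variable {N : Type*} [AddCommGroup N] {d k : ℕ} {ℓ : Fin k → ℕ} {e : N ≃+ Cochar d ℓ}
  (S : StackyFan e)

/-- `b_ρ ∈ N^rig`, the image of `e_ρ` under `β^rig : ℤ^{Σ(1)} → N → N^rig`. -/
def b (ρ : S.Ray) : Fin d → ℤ := (e (S.β (Finsupp.single ρ 1))).1

/-- `b_ρ` as a vector of `N_ℝ`. -/
def bR (ρ : S.Ray) : Fin d → ℝ := fun i => (S.b ρ i : ℝ)

/-- `x = ∑_{ρ ∈ σ(1)} u_ρ b_ρ` with all `u_ρ ≥ 0`. -/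
def IsExpansion (σ : PointedCone ℝ (Fin d → ℝ)) (x : Fin d → ℝ) (u : S.Ray → ℝ) : Prop :=
  (∀ ρ, 0 ≤ u ρ) ∧ (∀ ρ : S.Ray, ¬ ρ.1 ≤ σ → u ρ = 0) ∧ x = ∑ ρ, u ρ • S.bR ρ

open Classical in
/-- The numbers `a_ρ(x)`, `ρ ∈ Σ(1)`, for `x ∈ N_ℝ`: the coefficients of the expansion of `x` in any
cone `σ ∈ Σ` that contains `x`, and `0` for `ρ ∉ σ(1)`. The expansion does not depend on `σ`. -/
def a (x : Fin d → ℝ) : S.Ray → ℝ :=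
  if h : ∃ u, ∃ σ ∈ S.cones, S.IsExpansion σ x u then h.choose else 0

/-- `a_ρ` on `N^rig`. -/
def aZ (y : Fin d → ℤ) : S.Ray → ℝ := S.a (fun i => (y i : ℝ))

/-- `r(y) = ∑_ρ ⌊a_ρ(y)⌋ b_ρ`. -/
def r (y : Fin d → ℤ) : Fin d → ℤ := ∑ ρ, ⌊S.aZ y ρ⌋ • S.b ρ

/-- `q(y, g) = (y - r(y), g)`, where `y - r(y) = ∑_ρ {a_ρ(y)} b_ρ`. -/
def q (y : Cochar d ℓ) : Cochar d ℓ := (y.1 - S.r y.1, y.2)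

/-- `Box(σ)`. -/
def box (σ : PointedCone ℝ (Fin d → ℝ)) : Set (Cochar d ℓ) :=
  {y | ∃ u, S.IsExpansion σ (fun i => (y.1 i : ℝ)) u ∧ ∀ ρ, u ρ < 1}

/-- `Box(Σ) = ⋃_{σ ∈ Σ(d)} Box(σ)`, the set of sectors of the toric stack. -/
def Box : Set (Cochar d ℓ) := ⋃ σ ∈ S.conesOfDim d, S.box σ

/-- The twisted sectors: the elements of `Box(Σ)` other than the untwisted sector `0`. -/
abbrev TwistedSector : Type := {y : Cochar d ℓ // y ∈ S.Box ∧ y ≠ 0}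

/-- The space `ℝ^{Σ(1) ∪ π₀*(𝒥₀𝒳)}`. -/
abbrev Param : Type := S.Ray ⊕ S.TwistedSector → ℝ

/-- The linear forms `Ξ_ρ`, `ρ ∈ Σ(1)`, and `Ξ_𝒴`, `𝒴` a twisted sector. -/
def Xi : S.Ray ⊕ S.TwistedSector → (S.Param →ₗ[ℝ] ℝ)
  | .inl ρ => LinearMap.proj (.inl ρ)
  | .inr Y => LinearMap.proj (.inr Y) + ∑ ρ, S.aZ Y.1.1 ρ • LinearMap.proj (.inl ρ)

/-- The cone `Λ`. -/
def Lam : Set S.Param := {t | ∀ j, 0 ≤ S.Xi j t}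

/-- `Λ°`, the relative interior of `Λ`. -/
def LamInt : Set S.Param := intrinsicInterior ℝ S.Lam

/-! ### Heights -/

open Classical in
/-- `φ_s : N^rig × G^D → ℝ`. -/
def phi (s : S.Param) (y : Cochar d ℓ) : ℝ :=
  (if h : S.q y ∈ S.Box ∧ S.q y ≠ 0 then s (.inr ⟨S.q y, h⟩) else 0)
    + ∑ ρ, S.aZ y.1 ρ * s (.inl ρ)

/-- `φ_s^∞ : N_ℝ → ℝ`, the piecewise linear function with `φ_s^∞(b_ρ) = s_ρ`. -/
def phiInf (s : S.Param) (x : Fin d → ℝ) : ℝ := ∑ ρ, S.a x ρ * s (.inl ρ)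

end StackyFan

section Local

variable {F : Type*} [Field F] [NumberField F]

/-- The normalized valuation `ord_v : F_vˣ → ℤ` at a finite place `v`. -/
def ord (v : HeightOneSpectrum (𝓞 F)) : (v.adicCompletion F)ˣ →* Multiplicative ℤ :=
  (WithZero.unitsWithZeroEquiv.toMonoidHom.comp
    (Units.map (Valued.v (R := v.adicCompletion F)).toMonoidWithZeroHom.toMonoidHom))⁻¹

/-- `log_{Bμ_n, v} : F_vˣ / (F_vˣ)^n → ℤ/n`, induced by `ord_v`. -/
def logBMu (n : ℕ) (v : HeightOneSpectrum (𝓞 F)) :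
    BMu n (v.adicCompletion F) →* Multiplicative (ZMod n) :=
  QuotientGroup.lift _ ((AddMonoidHom.toMultiplicative (Int.castAddHom (ZMod n))).comp (ord v)) (by
    rintro _ ⟨x, rfl⟩
    apply Multiplicative.toAdd.injective
    simp)

/-- `log_{𝒯, v} : 𝒯(F_v) → N^rig × G^D` at a finite place `v`. -/
def logFin {d k : ℕ} {ℓ : Fin k → ℕ} (v : HeightOneSpectrum (𝓞 F))
    (x : TorusPoints d ℓ (v.adicCompletion F)) : Cochar d ℓ :=
  (fun i => (ord v (x.1 i)).toAdd, fun i => (logBMu (ℓ i) v (x.2 i)).toAdd)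

/-- `log_{𝒯, v} : 𝒯(F_v) → N_ℝ` at an infinite place `v`. The sign is the one for which
`∑_v log(q_v) log_{𝒯, v}` vanishes on `𝒯(F)`. -/
def logInf {d k : ℕ} {ℓ : Fin k → ℕ} (v : InfinitePlace F)
    (x : TorusPoints d ℓ v.Completion) : Fin d → ℝ :=
  fun i => - Real.log ‖(x.1 i : v.Completion)‖

end Local

namespace StackyFan

variable {N : Type*} [AddCommGroup N] {d k : ℕ} {ℓ : Fin k → ℕ} {e : N ≃+ Cochar d ℓ}
  (S : StackyFan e) {F : Type*} [Field F] [NumberField F]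

/-- The local height pairing at a finite place, `q_v ^ φ_s(log_{𝒯, v}(x))`. -/
def localHeightFin (v : HeightOneSpectrum (𝓞 F)) (s : S.Param)
    (x : TorusPoints d ℓ (v.adicCompletion F)) : ℝ :=
  Real.exp (Real.log (Ideal.absNorm v.asIdeal) * S.phi s (logFin v x))

/-- The local height pairing at an infinite place. -/
def localHeightInf (v : InfinitePlace F) (s : S.Param)
    (x : TorusPoints d ℓ v.Completion) : ℝ :=
  Real.exp ((v.mult : ℝ) * S.phiInf s (logInf v x))

/-- The height `H_s(x) = ∏_v H_v(s, i_v(x))` on `𝒯(F)`; for every `x` almost all factors are `1`. -/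
def height (s : S.Param) (x : TorusPoints d ℓ F) : ℝ :=
  (∏ᶠ v : HeightOneSpectrum (𝓞 F),
      S.localHeightFin v s (x.map (algebraMap F (v.adicCompletion F)))) *
    ∏ v : InfinitePlace F, S.localHeightInf v s (x.map (algebraMap F v.Completion))

end StackyFan

end ToricStack

end

/-! This is a Northcott argument. On `Λ°` every form `Ξ_j(t)` is positive; there are finitely many
of them, so all are at least some `m > 0`. Split each `a_ρ` into floor and fractional part. If
`q(y)` is a twisted sector, the fractional parts combine with `t_{q(y)}` into `Ξ_{q(y)}(t)`, so
`φ_t(y) ≥ m (1 + ∑ ⌊a_ρ(y)⌋)`; otherwise `φ_t(y) = φ_t^∞(y)`. By completeness the `a_ρ` control the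
coordinates. Hence for some `c > 0` both `φ_t` and `φ_t^∞` dominate `c` times each coordinate, and
`φ_t ≥ c` away from `0` (`exists_phi_lower_bound`).

Every local factor is then at least `1`, so `H_t(x) ≤ B` bounds by a power of `B`: for each `x_j`,
the product of the `q_v ^ |ord_v x_j|` and every archimedean `|x_j|_w`; for each `z_i`, the product
of the `q_v` with `ord_v z_i ≢ 0 mod ℓ_i`. Such an `x_j` is an algebraic integer with bounded
conjugates divided by a bounded positive integer (`polyBounded_units`). The residues of `z_i` define
an integral ideal of bounded norm, which fixes `z_i` up to classes with all residues zero; these are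
finite in number by finiteness of the class group and finite generation of the units
(`finite_ordMod_eq_zero`, `polyBounded_BMu`). The bounds multiply over the coordinates. -/

namespace ToricStack

/-! ### Simplicial cones and their one-dimensional faces -/

section SimplicialCones

variable {V : Type*} [AddCommGroup V] [Module ℝ V]

theorem exists_generators_of_isSimplicial {σ : PointedCone ℝ V} (hσ : σ.IsSimplicial) :
    ∃ s : Set V, s.Finite ∧ LinearIndependent ℝ (fun v : s => (v : V)) ∧
      ∀ [Fintype s] (x : V), x ∈ σ ↔ ∃ c : s → ℝ, (∀ i, 0 ≤ c i) ∧ x = ∑ i, c i • (i : V) := by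
  obtain ⟨s, hs, hli, rfl⟩ := hσ
  refine ⟨s, hs, hli, fun {_} x => ?_⟩
  constructor
  · intro hx
    have hx' : x ∈ Submodule.span {c : ℝ // 0 ≤ c} (Set.range (fun v : s => (v : V))) := by
      rw [Subtype.range_coe]; exact hx
    obtain ⟨c, rfl⟩ := (Submodule.mem_span_range_iff_exists_fun _).1 hx'
    exact ⟨fun i => (c i : ℝ), fun i => (c i).2, rfl⟩
  · rintro ⟨c, hc, rfl⟩
    exact Submodule.sum_mem _ fun i _ =>
      Submodule.smul_mem _ (⟨c i, hc i⟩ : {c : ℝ // 0 ≤ c}) (Submodule.subset_span i.2)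

theorem mem_hull_singleton {v x : V} :
    x ∈ PointedCone.hull ℝ ({v} : Set V) ↔ ∃ k : ℝ, 0 ≤ k ∧ x = k • v := by
  refine Submodule.mem_span_singleton.trans ⟨?_, ?_⟩
  · rintro ⟨k, rfl⟩
    exact ⟨k, k.2, rfl⟩
  · rintro ⟨k, hk, rfl⟩
    exact ⟨⟨k, hk⟩, rfl⟩

theorem smul_mem_pointedCone (σ : PointedCone ℝ V) {c : ℝ} (hc : 0 ≤ c) {x : V} (hx : x ∈ σ) :
    c • x ∈ σ :=
  Submodule.smul_mem σ (⟨c, hc⟩ : {c : ℝ // 0 ≤ c}) hx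

/-- Compare coordinates: away from `i`, those of `a • x + y` vanish, and being sums of nonnegative
terms with `a > 0` they force those of `x` to vanish. -/
theorem hull_singleton_isFaceOf {ι : Type*} [Fintype ι] {w : ι → V} (hw : LinearIndependent ℝ w)
    {σ : PointedCone ℝ V}
    (hσ : ∀ x : V, x ∈ σ ↔ ∃ c : ι → ℝ, (∀ i, 0 ≤ c i) ∧ x = ∑ i, c i • w i) (i : ι) :
    (PointedCone.hull ℝ ({w i} : Set V)).IsFaceOf σ := by
  classical
  have hwi : w i ∈ σ := (hσ _).2 ⟨Pi.single i 1, fun j => by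
    by_cases h : j = i
    · subst h; simp
    · simp [h], by simp [Pi.single_apply]⟩
  constructor
  · intro x hx
    obtain ⟨k, hk, rfl⟩ := mem_hull_singleton.1 hx
    exact smul_mem_pointedCone σ hk hwi
  · intro x y a hx hy ha hxy
    obtain ⟨c, hc, rfl⟩ := (hσ x).1 hx
    obtain ⟨c', hc', rfl⟩ := (hσ y).1 hy
    obtain ⟨k, hk, h⟩ := mem_hull_singleton.1 hxy
    have h' : ∑ j, (a * c j + c' j) • w j = ∑ j, (Pi.single i k : ι → ℝ) j • w j := by
      simp only [add_smul, mul_smul, Finset.sum_add_distrib, ← Finset.smul_sum]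
      rw [h]
      simp [Pi.single_apply]
    have hco := (Fintype.linearIndependent_iffₛ.1 hw) _ _ h'
    refine mem_hull_singleton.2 ⟨c i, hc i, ?_⟩
    refine Finset.sum_eq_single i (fun j _ hj => ?_) (by simp)
    have := hco j
    rw [Pi.single_eq_of_ne hj] at this
    have h1 : 0 ≤ a * c j := mul_nonneg ha.le (hc j)
    have h2 : a * c j = 0 := le_antisymm (by linarith [hc' j]) h1
    rw [(mul_eq_zero.1 h2).resolve_left ha.ne', zero_smul]

theorem finrank_span_hull_singleton {v : V} (hv : v ≠ 0) :
    Module.finrank ℝ (Submodule.span ℝ (PointedCone.hull ℝ ({v} : Set V) : Set V)) = 1 := by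
  have : Submodule.span ℝ (PointedCone.hull ℝ ({v} : Set V) : Set V) = Submodule.span ℝ {v} := by
    apply le_antisymm
    · refine Submodule.span_le.2 fun x hx => ?_
      obtain ⟨k, _, rfl⟩ := mem_hull_singleton.1 hx
      exact Submodule.smul_mem _ _ (Submodule.mem_span_singleton_self v)
    · refine Submodule.span_mono fun x hx => ?_
      exact mem_hull_singleton.2 ⟨1, zero_le_one, by simpa using hx⟩
  rw [this, finrank_span_singleton hv]

/-- Independent generators inside a one-dimensional span number at most one. -/
theorem exists_eq_smul_of_finrank_span_eq_one [FiniteDimensional ℝ V] {ρ : PointedCone ℝ V}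
    (hρ : ρ.IsSimplicial) (h1 : Module.finrank ℝ (Submodule.span ℝ (ρ : Set V)) = 1)
    {b x : V} (hb : b ∈ ρ) (hb0 : b ≠ 0) (hx : x ∈ ρ) : ∃ k : ℝ, 0 ≤ k ∧ x = k • b := by
  classical
  obtain ⟨s, hs, hli, hmem⟩ := exists_generators_of_isSimplicial hρ
  have := hs.fintype
  have hsρ : ∀ i : s, (i : V) ∈ ρ := fun i => (hmem _).2 ⟨Pi.single i 1, fun j => by
    by_cases h : j = i
    · subst h; simp
    · simp [h], by simp [Pi.single_apply]⟩
  have hcard : Fintype.card s ≤ 1 := by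
    rw [← h1]
    let w : s → Submodule.span ℝ (ρ : Set V) := fun i => ⟨i, Submodule.subset_span (hsρ i)⟩
    have hw : LinearIndependent ℝ w := LinearIndependent.of_comp (Submodule.subtype _) hli
    exact hw.fintype_card_le_finrank
  have hsub : Subsingleton s := Fintype.card_le_one_iff_subsingleton.1 hcard
  obtain ⟨c, hc, rfl⟩ := (hmem b).1 hb
  obtain ⟨c', hc', rfl⟩ := (hmem x).1 hx
  obtain ⟨i, -, hi⟩ := Finset.exists_ne_zero_of_sum_ne_zero hb0
  have hu : (Finset.univ : Finset s) = {i} := by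
    ext j; simp [Subsingleton.elim j i]
  have hci : c i ≠ 0 := fun h => hi (by rw [h, zero_smul])
  refine ⟨c' i / c i, div_nonneg (hc' i) (hc i), ?_⟩
  rw [hu, Finset.sum_singleton, Finset.sum_singleton, smul_smul, div_mul_cancel₀ _ hci]

end SimplicialCones

/-! ### Expansions in a stacky fan, sectors, and lower bounds for `φ_t` -/

namespace StackyFan

variable {N : Type*} [AddCommGroup N] {d k : ℕ} {ℓ : Fin k → ℕ} {e : N ≃+ Cochar d ℓ}
  (S : StackyFan e)

theorem bR_mem (ρ : S.Ray) : S.bR ρ ∈ ρ.1 := S.β_mem ρ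

theorem bR_ne_zero (ρ : S.Ray) : S.bR ρ ≠ 0 := by
  intro h
  apply S.β_ne_zero ρ
  funext i
  have := congrFun h i
  simpa [bR, b] using this

theorem exists_eq_smul_bR (ρ : S.Ray) {x : Fin d → ℝ} (hx : x ∈ ρ.1) :
    ∃ k : ℝ, 0 ≤ k ∧ x = k • S.bR ρ :=
  exists_eq_smul_of_finrank_span_eq_one (S.simplicial _ ρ.2.1) ρ.2.2 (S.bR_mem ρ)
    (S.bR_ne_zero ρ) hx

theorem ray_le_iff (ρ : S.Ray) (σ : PointedCone ℝ (Fin d → ℝ)) : ρ.1 ≤ σ ↔ S.bR ρ ∈ σ := by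
  refine ⟨fun h => h (S.bR_mem ρ), fun h x hx => ?_⟩
  obtain ⟨k, hk, rfl⟩ := S.exists_eq_smul_bR ρ hx
  exact smul_mem_pointedCone σ hk h

/-- A ray inside `σ` is its intersection with `σ`, hence a face, so it contains a generator of `σ`.
Thus the `b_ρ` are positive multiples of generators, distinct ones for distinct rays. -/
theorem linearIndependent_bR {σ : PointedCone ℝ (Fin d → ℝ)} (hσ : σ ∈ S.cones) :
    LinearIndependent ℝ (fun ρ : {ρ : S.Ray // ρ.1 ≤ σ} => S.bR ρ.1) := by
  obtain ⟨s, hs, hli, hmem⟩ := exists_generators_of_isSimplicial (S.simplicial σ hσ)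
  classical
  have := hs.fintype
  have hsσ : ∀ i : s, (i : Fin d → ℝ) ∈ σ := fun i => (hmem _).2 ⟨Pi.single i 1, fun j => by
    by_cases h : j = i
    · subst h; simp
    · simp [h], by simp [Pi.single_apply]⟩
  have key : ∀ ρ : {ρ : S.Ray // ρ.1 ≤ σ}, ∃ i : s, ∃ c : ℝˣ,
      0 < (c : ℝ) ∧ S.bR ρ.1 = c • (i : Fin d → ℝ) := by
    rintro ⟨ρ, hρ⟩
    have hface : ρ.1.IsFaceOf σ := by
      have := S.inter_face σ hσ ρ.1 ρ.2.1
      rwa [inf_eq_right.2 hρ] at this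
    obtain ⟨c, hc, hb⟩ := (hmem _).1 (hρ (S.bR_mem ρ))
    have hne : ∑ i, c i • (i : Fin d → ℝ) ≠ 0 := hb ▸ S.bR_ne_zero ρ
    obtain ⟨i, -, hi⟩ := Finset.exists_ne_zero_of_sum_ne_zero hne
    have hci : 0 < c i := lt_of_le_of_ne (hc i) fun h => hi (by rw [← h, zero_smul])
    have hi' : (i : Fin d → ℝ) ∈ ρ.1 := hface.mem_of_sum_smul_mem hsσ hc
      (hb ▸ S.bR_mem ρ) i hci
    obtain ⟨m, hm, him⟩ := S.exists_eq_smul_bR ρ hi'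
    have hm0 : m ≠ 0 := fun h => hli.ne_zero i (by rw [him, h, zero_smul])
    refine ⟨i, Units.mk0 m⁻¹ (inv_ne_zero hm0), by simpa using lt_of_le_of_ne hm hm0.symm, ?_⟩
    rw [Units.smul_def, him, smul_smul]
    simp [hm0]
  choose f c hc hf using key
  have hinj : Function.Injective f := by
    have aux : ∀ ρ ρ', f ρ = f ρ' → ρ.1.1 ≤ ρ'.1.1 := by
      intro ρ ρ' h
      rw [S.ray_le_iff]
      have h1 := hf ρ
      have h2 := hf ρ'
      rw [← h] at h2
      have : S.bR ρ.1 = ((c ρ : ℝ) * (c ρ' : ℝ)⁻¹) • S.bR ρ'.1 := by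
        rw [h1, h2, Units.smul_def, Units.smul_def, smul_smul, mul_assoc,
          inv_mul_cancel₀ (hc ρ').ne', mul_one]
      rw [this]
      exact smul_mem_pointedCone _ (mul_nonneg (hc ρ).le (inv_nonneg.2 (hc ρ').le)) (S.bR_mem _)
    intro ρ ρ' h
    exact Subtype.ext (Subtype.ext (le_antisymm (aux _ _ h) (aux _ _ h.symm)))
  have h : (fun ρ : {ρ : S.Ray // ρ.1 ≤ σ} => S.bR ρ.1) =
      c • ((fun v : s => (v : Fin d → ℝ)) ∘ f) := funext hf
  rw [h]
  exact (hli.comp f hinj).units_smul c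

theorem IsExpansion.eq_of_same_cone {σ : PointedCone ℝ (Fin d → ℝ)} (hσ : σ ∈ S.cones)
    {x : Fin d → ℝ} {u u' : S.Ray → ℝ} (h : S.IsExpansion σ x u) (h' : S.IsExpansion σ x u') :
    u = u' := by
  classical
  have hres : ∀ w : S.Ray → ℝ, (∀ ρ : S.Ray, ¬ ρ.1 ≤ σ → w ρ = 0) →
      ∑ ρ, w ρ • S.bR ρ = ∑ ρ : {ρ : S.Ray // ρ.1 ≤ σ}, w ρ.1 • S.bR ρ.1 := by
    intro w hw
    rw [← Finset.sum_subtype (Finset.univ.filter fun ρ : S.Ray => ρ.1 ≤ σ) (by simp)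
      (fun ρ => w ρ • S.bR ρ)]
    refine (Finset.sum_filter_of_ne fun ρ _ hne => ?_).symm
    by_contra hρ
    exact hne (by rw [hw ρ hρ, zero_smul])
  have hu := (Fintype.linearIndependent_iffₛ.1 (S.linearIndependent_bR hσ))
    (fun ρ => u ρ.1) (fun ρ => u' ρ.1)
    (by rw [← hres u h.2.1, ← hres u' h'.2.1, ← h.2.2, ← h'.2.2])
  funext ρ
  by_cases hρ : ρ.1 ≤ σ
  · exact hu ⟨ρ, hρ⟩
  · rw [h.2.1 ρ hρ, h'.2.1 ρ hρ]

theorem IsExpansion.smul_bR_mem {σ : PointedCone ℝ (Fin d → ℝ)}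
    {x : Fin d → ℝ} {u : S.Ray → ℝ} (h : S.IsExpansion σ x u) (ρ : S.Ray) :
    u ρ • S.bR ρ ∈ σ := by
  by_cases hρ : ρ.1 ≤ σ
  · exact smul_mem_pointedCone _ (h.1 ρ) (hρ (S.bR_mem ρ))
  · rw [h.2.1 ρ hρ, zero_smul]
    exact zero_mem _

theorem IsExpansion.mem {σ : PointedCone ℝ (Fin d → ℝ)}
    {x : Fin d → ℝ} {u : S.Ray → ℝ} (h : S.IsExpansion σ x u) : x ∈ σ := by
  rw [h.2.2]
  exact Submodule.sum_mem _ fun ρ _ => h.smul_bR_mem S ρ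

theorem IsExpansion.unique {σ τ : PointedCone ℝ (Fin d → ℝ)} (hσ : σ ∈ S.cones) (hτ : τ ∈ S.cones)
    {x : Fin d → ℝ} {u u' : S.Ray → ℝ} (h : S.IsExpansion σ x u) (h' : S.IsExpansion τ x u') :
    u = u' := by
  -- The expansion in `σ` is also one in `τ`: `σ ⊓ τ` is a face of `σ` containing the sum, hence
  -- each summand, so every ray with nonzero coefficient lies in `τ`.
  refine IsExpansion.eq_of_same_cone S hτ (x := x) ⟨h.1, fun ρ hρ => ?_, h.2.2⟩ h'
  by_contra h0
  apply hρ
  have hx : ∑ ρ, u ρ • S.bR ρ ∈ σ ⊓ τ := by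
    rw [← h.2.2]
    exact ⟨h.mem S, h'.mem S⟩
  have hm := (S.inter_face σ hσ τ hτ).mem_of_sum_mem (h.smul_bR_mem S) hx ρ
  rw [S.ray_le_iff]
  have := smul_mem_pointedCone τ (inv_nonneg.2 (h.1 ρ)) hm.2
  rwa [smul_smul, inv_mul_cancel₀ h0, one_smul] at this

theorem exists_isExpansion {σ : PointedCone ℝ (Fin d → ℝ)} (hσ : σ ∈ S.cones)
    {x : Fin d → ℝ} (hx : x ∈ σ) : ∃ u, S.IsExpansion σ x u := by
  classical
  obtain ⟨s, hs, hli, hmem⟩ := exists_generators_of_isSimplicial (S.simplicial σ hσ)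
  have := hs.fintype
  have key : ∀ i : s, ∃ ρ : S.Ray, ∃ m : ℝ, 0 ≤ m ∧ ρ.1 ≤ σ ∧ (i : Fin d → ℝ) = m • S.bR ρ := by
    intro i
    have hface := hull_singleton_isFaceOf hli hmem i
    let ρ : S.Ray := ⟨PointedCone.hull ℝ {(i : Fin d → ℝ)}, S.face_mem σ hσ _ hface,
      finrank_span_hull_singleton (hli.ne_zero i)⟩
    obtain ⟨m, hm, h⟩ := S.exists_eq_smul_bR ρ (x := i)
      (mem_hull_singleton.2 ⟨1, zero_le_one, (one_smul _ _).symm⟩)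
    exact ⟨ρ, m, hm, hface.le, h⟩
  choose f m hm hf hi using key
  obtain ⟨c, hc, rfl⟩ := (hmem x).1 hx
  -- Summing over the fibre of `f` avoids having to show that distinct generators give distinct
  -- rays.
  refine ⟨fun ρ => ∑ i, if f i = ρ then c i * m i else 0, fun ρ => ?_, fun ρ hρ => ?_, ?_⟩
  · refine Finset.sum_nonneg fun i _ => ?_
    split_ifs
    · exact mul_nonneg (hc i) (hm i)
    · exact le_rfl
  · refine Finset.sum_eq_zero fun i _ => if_neg ?_
    rintro rfl
    exact hρ (hf i)
  · simp only [Finset.sum_smul, ite_smul, zero_smul]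
    rw [Finset.sum_comm]
    refine Finset.sum_congr rfl fun i _ => ?_
    rw [Finset.sum_ite_eq, if_pos (Finset.mem_univ _), mul_smul, ← hi]

theorem a_eq_of_isExpansion {σ : PointedCone ℝ (Fin d → ℝ)} (hσ : σ ∈ S.cones)
    {x : Fin d → ℝ} {u : S.Ray → ℝ} (h : S.IsExpansion σ x u) : S.a x = u := by
  have hex : ∃ u, ∃ σ ∈ S.cones, S.IsExpansion σ x u := ⟨u, σ, hσ, h⟩
  rw [a, dif_pos hex]
  obtain ⟨τ, hτ, h'⟩ := hex.choose_spec
  exact h'.unique S hτ hσ h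

theorem exists_isExpansion_a (hS : S.IsComplete) (x : Fin d → ℝ) :
    ∃ σ ∈ S.cones, S.IsExpansion σ x (S.a x) := by
  obtain ⟨σ, hσ, hx⟩ := hS x
  obtain ⟨u, hu⟩ := S.exists_isExpansion hσ hx
  exact ⟨σ, hσ, by rwa [S.a_eq_of_isExpansion hσ hu]⟩

theorem a_nonneg (x : Fin d → ℝ) (ρ : S.Ray) : 0 ≤ S.a x ρ := by
  unfold a
  split_ifs with h
  · obtain ⟨σ, _, hu⟩ := h.choose_spec
    exact hu.1 ρ
  · exact le_rfl

theorem sum_a_smul_bR (hS : S.IsComplete) (x : Fin d → ℝ) : ∑ ρ, S.a x ρ • S.bR ρ = x := by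
  obtain ⟨_, _, h⟩ := S.exists_isExpansion_a hS x
  exact h.2.2.symm

theorem a_zero (hS : S.IsComplete) : S.a 0 = 0 := by
  obtain ⟨σ, hσ, _⟩ := hS 0
  exact S.a_eq_of_isExpansion hσ ⟨fun _ => le_rfl, fun _ _ => rfl, by simp⟩

theorem aZ_zero (hS : S.IsComplete) : S.aZ 0 = 0 := by
  unfold aZ
  rw [← S.a_zero hS]
  congr 1
  funext i
  simp

theorem cast_q (hS : S.IsComplete) (y : Cochar d ℓ) :
    (fun i => ((S.q y).1 i : ℝ)) = ∑ ρ, Int.fract (S.aZ y.1 ρ) • S.bR ρ := by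
  have h := S.sum_a_smul_bR hS (fun i => (y.1 i : ℝ))
  funext i
  have hi := congrFun h i
  simp only [Finset.sum_apply, Pi.smul_apply, smul_eq_mul] at hi ⊢
  simp only [q, r, Pi.sub_apply, Finset.sum_apply, Pi.smul_apply, smul_eq_mul, Int.cast_sub,
    Int.cast_sum, Int.cast_mul]
  rw [← hi, ← Finset.sum_sub_distrib]
  refine Finset.sum_congr rfl fun ρ _ => ?_
  simp only [Int.fract, bR, aZ]
  ring

/-- Taking fractional parts keeps zero coefficients zero, so the result is an expansion in the same
cone, and expansions are unique. -/
theorem aZ_q (hS : S.IsComplete) (y : Cochar d ℓ) (ρ : S.Ray) :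
    S.aZ (S.q y).1 ρ = Int.fract (S.aZ y.1 ρ) := by
  obtain ⟨σ, hσ, h⟩ := S.exists_isExpansion_a hS (fun i => (y.1 i : ℝ))
  have : S.IsExpansion σ (fun i => ((S.q y).1 i : ℝ)) (fun ρ => Int.fract (S.aZ y.1 ρ)) := by
    refine ⟨fun ρ => Int.fract_nonneg _, fun ρ hρ => ?_, S.cast_q hS y⟩
    have := h.2.1 ρ hρ
    simp [aZ, this]
  exact congrFun (S.a_eq_of_isExpansion hσ this) ρ

/-- A real vector space is not a finite union of proper subspaces, so the span of some cone is
everything. -/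
theorem exists_mem_conesOfDim (hS : S.IsComplete) : ∃ σ, σ ∈ S.conesOfDim d := by
  have := S.finite_cones.to_subtype
  obtain ⟨σ, hσ⟩ := Subspace.exists_eq_top_of_iUnion_eq_univ
    (p := fun σ : S.cones => Submodule.span ℝ (σ.1 : Set (Fin d → ℝ))) (by
      refine Set.eq_univ_of_forall fun x => ?_
      obtain ⟨σ, hσ, hx⟩ := hS x
      exact Set.mem_iUnion.2 ⟨⟨σ, hσ⟩, Submodule.subset_span hx⟩)
  exact ⟨σ.1, σ.2, by rw [hσ, finrank_top, Module.finrank_fin_fun]⟩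

theorem mem_Box_of_fst_eq_zero (hS : S.IsComplete) {y : Cochar d ℓ} (hy : y.1 = 0) :
    y ∈ S.Box := by
  obtain ⟨σ, hσ⟩ := S.exists_mem_conesOfDim hS
  refine Set.mem_biUnion hσ ⟨0, ⟨fun _ => le_rfl, fun _ _ => rfl, ?_⟩, fun _ => zero_lt_one⟩
  rw [hy]
  funext i
  simp

theorem finite_Box (hℓ : ∀ i, 0 < ℓ i) : S.Box.Finite := by
  have : ∀ i, NeZero (ℓ i) := fun i => ⟨(hℓ i).ne'⟩
  obtain ⟨C, hC⟩ : ∃ C : ℤ, ∀ i, ∑ ρ, |S.b ρ i| ≤ C := by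
    obtain ⟨C, hC⟩ := (Set.finite_range fun i => ∑ ρ, |S.b ρ i|).bddAbove
    exact ⟨C, fun i => hC ⟨i, rfl⟩⟩
  refine Set.Finite.subset ((Set.finite_Icc (fun _ : Fin d => -C) (fun _ => C)).prod
    (Set.finite_univ (α := ∀ i : Fin k, ZMod (ℓ i)))) fun y hy => ⟨?_, trivial⟩
  obtain ⟨σ, hσ, u, hu, hu1⟩ := Set.mem_iUnion₂.1 hy
  have key : ∀ i, |y.1 i| ≤ C := by
    intro i
    have hi := congrFun hu.2.2 i
    simp only [Finset.sum_apply, Pi.smul_apply, smul_eq_mul] at hi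
    have : (|y.1 i| : ℝ) ≤ ∑ ρ, (|S.b ρ i| : ℝ) := by
      rw [hi]
      refine (Finset.abs_sum_le_sum_abs _ _).trans (Finset.sum_le_sum fun ρ _ => ?_)
      rw [abs_mul, abs_of_nonneg (hu.1 ρ)]
      exact mul_le_of_le_one_left (abs_nonneg _) (hu1 ρ).le
    exact le_trans (by exact_mod_cast this) (hC i)
  exact ⟨fun i => (abs_le.1 (key i)).1, fun i => (abs_le.1 (key i)).2⟩

/-- From a relative interior point `t` one can step slightly past `t`, away from a point `p` of `Λ`
where all forms are at least `1`, without leaving `Λ`. A form vanishing at `t` would become negative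
there. -/
theorem Xi_pos_of_mem_LamInt {t : S.Param} (ht : t ∈ S.LamInt) (j : S.Ray ⊕ S.TwistedSector) :
    0 < S.Xi j t := by
  let p : S.Param := fun _ => 1
  have hp : ∀ j, 1 ≤ S.Xi j p := by
    rintro (ρ | Y)
    · simp [Xi, p]
    · simp only [Xi, LinearMap.add_apply, LinearMap.proj_apply, LinearMap.coe_sum,
        Finset.sum_apply, LinearMap.smul_apply, smul_eq_mul, p, mul_one]
      linarith [Finset.sum_nonneg fun ρ (_ : ρ ∈ Finset.univ) =>
        S.a_nonneg (fun i => (Y.1.1 i : ℝ)) ρ, show ∑ ρ, S.aZ Y.1.1 ρ =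
          ∑ ρ, S.a (fun i => (Y.1.1 i : ℝ)) ρ from rfl]
  have hpL : p ∈ S.Lam := fun j => zero_le_one.trans (hp j)
  obtain ⟨t', ht', htt⟩ := mem_intrinsicInterior.1 ht
  have htL : t ∈ S.Lam := intrinsicInterior_subset ht
  let g : ℝ → affineSpan ℝ S.Lam := fun s => ⟨AffineMap.lineMap t p s,
    AffineMap.lineMap_mem s (subset_affineSpan ℝ _ htL) (subset_affineSpan ℝ _ hpL)⟩
  have hg : Continuous g := Continuous.subtype_mk AffineMap.lineMap_continuous _
  have hg0 : g 0 = t' := Subtype.ext (by simp [g, htt])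
  have hmem : ∀ᶠ s in nhds (0 : ℝ), g s ∈ interior ((↑) ⁻¹' S.Lam : Set (affineSpan ℝ S.Lam)) :=
    hg.continuousAt.eventually (by rw [hg0]; exact isOpen_interior.mem_nhds ht')
  obtain ⟨ε, hε, hball⟩ := Metric.eventually_nhds_iff.1 hmem
  have hs : g (-(ε / 2)) ∈ interior ((↑) ⁻¹' S.Lam : Set (affineSpan ℝ S.Lam)) :=
    hball (by rw [dist_zero_right, norm_neg, Real.norm_of_nonneg (half_pos hε).le]; linarith)
  have : 0 ≤ S.Xi j (AffineMap.lineMap t p (-(ε / 2))) := interior_subset hs j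
  rw [AffineMap.lineMap_apply_module] at this
  simp only [map_add, map_smul, smul_eq_mul] at this
  have h1 := hp j
  by_contra! hneg
  nlinarith [mul_nonneg hε.le (sub_nonneg.2 h1), htL j]

theorem phi_zero (hS : S.IsComplete) (t : S.Param) : S.phi t 0 = 0 := by
  have hq : S.q (0 : Cochar d ℓ) = 0 := by
    simp [q, r, S.aZ_zero hS]
  unfold phi
  rw [dif_neg (fun h => h.2 hq)]
  simp [S.aZ_zero hS]

theorem phi_eq_Xi_add (hS : S.IsComplete) (t : S.Param) {y : Cochar d ℓ}
    (h : S.q y ∈ S.Box ∧ S.q y ≠ 0) :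
    S.phi t y = S.Xi (.inr ⟨S.q y, h⟩) t + ∑ ρ, (⌊S.aZ y.1 ρ⌋ : ℝ) * t (.inl ρ) := by
  unfold phi
  rw [dif_pos h]
  simp only [Xi, LinearMap.add_apply, LinearMap.proj_apply, LinearMap.coe_sum,
        Finset.sum_apply, LinearMap.smul_apply, smul_eq_mul, add_assoc]
  rw [← Finset.sum_add_distrib]
  congr 1
  refine Finset.sum_congr rfl fun ρ _ => ?_
  rw [S.aZ_q hS, ← add_mul, Int.fract_add_floor]

/-- On `Λ°` the functions `φ_t` and `φ_t^∞` dominate a multiple of the norm. -/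
theorem exists_phi_lower_bound (hℓ : ∀ i, 0 < ℓ i) (hS : S.IsComplete) {t : S.Param}
    (ht : t ∈ S.LamInt) :
    ∃ c : ℝ, 0 < c ∧ (∀ y : Cochar d ℓ, ∀ j, c * |(y.1 j : ℝ)| ≤ S.phi t y) ∧
      (∀ y : Cochar d ℓ, y ≠ 0 → c ≤ S.phi t y) ∧
      ∀ (x : Fin d → ℝ) (j : Fin d), c * |x j| ≤ S.phiInf t x := by
  have hΞ := S.Xi_pos_of_mem_LamInt ht
  have : Finite S.TwistedSector := ((S.finite_Box hℓ).subset fun _ h => h.1).to_subtype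
  have hmin : ∀ {ι : Type} [Finite ι] (f : ι → ℝ), (∀ i, 0 < f i) → ∃ m, 0 < m ∧ ∀ i, m ≤ f i := by
    intro ι _ f hf
    cases isEmpty_or_nonempty ι
    · exact ⟨1, zero_lt_one, fun i => isEmptyElim i⟩
    · obtain ⟨i, hi⟩ := Finite.exists_min f
      exact ⟨f i, hf i, hi⟩
  obtain ⟨m, hm, hmle⟩ := hmin (fun j => S.Xi j t) hΞ
  have hmρ : ∀ ρ, m ≤ t (.inl ρ) := fun ρ => hmle (.inl ρ)
  obtain ⟨K, hK1, hK⟩ : ∃ K : ℝ, 1 ≤ K ∧ ∀ ρ i, |S.bR ρ i| ≤ K := by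
    obtain ⟨K, hK⟩ := (Set.finite_range fun p : S.Ray × Fin d => |S.bR p.1 p.2|).bddAbove
    exact ⟨max 1 K, le_max_left _ _, fun ρ i => (hK ⟨(ρ, i), rfl⟩).trans (le_max_right _ _)⟩
  have hcoord : ∀ (x : Fin d → ℝ) j, |x j| ≤ K * ∑ ρ, S.a x ρ := by
    intro x j
    have hx := congrFun (S.sum_a_smul_bR hS x) j
    simp only [Finset.sum_apply, Pi.smul_apply, smul_eq_mul] at hx
    rw [← hx, Finset.mul_sum]
    refine (Finset.abs_sum_le_sum_abs _ _).trans (Finset.sum_le_sum fun ρ _ => ?_)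
    rw [abs_mul, abs_of_nonneg (S.a_nonneg x ρ), mul_comm]
    exact mul_le_mul_of_nonneg_right (hK ρ j) (S.a_nonneg x ρ)
  have hinf : ∀ x : Fin d → ℝ, m * ∑ ρ, S.a x ρ ≤ S.phiInf t x := by
    intro x
    unfold phiInf
    rw [Finset.mul_sum]
    refine Finset.sum_le_sum fun ρ _ => ?_
    rw [mul_comm]
    exact mul_le_mul_of_nonneg_left (hmρ ρ) (S.a_nonneg x ρ)
  set R : ℝ := (Fintype.card S.Ray : ℝ) with hR
  have hR0 : 0 ≤ R := Nat.cast_nonneg _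
  have hK0 : 0 < K := zero_lt_one.trans_le hK1
  -- `K` bounds the entries of the `b_ρ`; `R` is the total error in replacing each `a_ρ` by its
  -- floor.
  set D : ℝ := K * (1 + R) with hD
  have hD1 : 1 ≤ D := by nlinarith
  have hD0 : 0 < D := zero_lt_one.trans_le hD1
  have hdiv : ∀ z w : ℝ, m * z ≤ D * w → m / D * z ≤ w := by
    intro z w h
    rw [div_mul_eq_mul_div, div_le_iff₀ hD0, mul_comm w]
    exact h
  have hsum0 : ∀ x, 0 ≤ ∑ ρ, S.a x ρ := fun x => Finset.sum_nonneg fun ρ _ => S.a_nonneg x ρ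
  have hinf' : ∀ (x : Fin d → ℝ) (j : Fin d), m / D * |x j| ≤ S.phiInf t x := by
    intro x j
    apply hdiv
    have h1 := mul_le_mul_of_nonneg_left (hcoord x j) hm.le
    have h2 := mul_le_mul_of_nonneg_left (hinf x) hK0.le
    have h3 : 0 ≤ S.phiInf t x := (mul_nonneg hm.le (hsum0 x)).trans (hinf x)
    have h4 : 0 ≤ K * R * S.phiInf t x := by positivity
    rw [hD]
    linarith
  have hfin : ∀ y : Cochar d ℓ, y ≠ 0 →
      m / D ≤ S.phi t y ∧ ∀ j, m / D * |(y.1 j : ℝ)| ≤ S.phi t y := by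
    intro y hy
    by_cases hq : S.q y ∈ S.Box ∧ S.q y ≠ 0
    · have hfl : m * ∑ ρ, (⌊S.aZ y.1 ρ⌋ : ℝ) ≤ ∑ ρ, (⌊S.aZ y.1 ρ⌋ : ℝ) * t (.inl ρ) := by
        rw [Finset.mul_sum]
        refine Finset.sum_le_sum fun ρ _ => ?_
        rw [mul_comm]
        refine mul_le_mul_of_nonneg_left (hmρ ρ) ?_
        exact_mod_cast Int.floor_nonneg.2 (S.a_nonneg _ ρ)
      have hfl0 : (0 : ℝ) ≤ ∑ ρ, (⌊S.aZ y.1 ρ⌋ : ℝ) := Finset.sum_nonneg fun ρ _ => by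
        exact_mod_cast Int.floor_nonneg.2 (S.a_nonneg _ ρ)
      have hφ := S.phi_eq_Xi_add hS t hq
      have hX := hmle (.inr ⟨S.q y, hq⟩)
      have hle : ∑ ρ, S.aZ y.1 ρ ≤ ∑ ρ, (⌊S.aZ y.1 ρ⌋ : ℝ) + R := by
        rw [hR, ← Finset.card_univ, ← nsmul_one, ← Finset.sum_const, ← Finset.sum_add_distrib]
        exact Finset.sum_le_sum fun ρ _ => (Int.lt_floor_add_one _).le
      have hm' : m * (1 + ∑ ρ, (⌊S.aZ y.1 ρ⌋ : ℝ)) ≤ S.phi t y := by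
        rw [hφ]; linarith
      refine ⟨(div_le_self hm.le hD1).trans (by nlinarith), fun j => hdiv _ _ ?_⟩
      have h1 : |(y.1 j : ℝ)| ≤ K * ∑ ρ, S.aZ y.1 ρ :=
        hcoord (fun i => (y.1 i : ℝ)) j
      have h2 : |(y.1 j : ℝ)| ≤ D * (1 + ∑ ρ, (⌊S.aZ y.1 ρ⌋ : ℝ)) := by
        refine h1.trans ?_
        rw [hD, mul_assoc]
        refine mul_le_mul_of_nonneg_left (hle.trans ?_) hK0.le
        nlinarith
      calc m * |(y.1 j : ℝ)| ≤ m * (D * (1 + ∑ ρ, (⌊S.aZ y.1 ρ⌋ : ℝ))) := by gcongr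
        _ = D * (m * (1 + ∑ ρ, (⌊S.aZ y.1 ρ⌋ : ℝ))) := by ring
        _ ≤ D * S.phi t y := by gcongr
    · have hφ : S.phi t y = S.phiInf t (fun i => (y.1 i : ℝ)) := by
        unfold phi
        rw [dif_neg hq, zero_add]
        rfl
      -- A nonzero purely torsion `y` is its own `q(y)` and lies in the box, so it belongs to the
      -- other case. Hence some integer coordinate has absolute value at least `1`.
      have hy1 : y.1 ≠ 0 := by
        intro h0
        have hqy : S.q y = y := by
          refine Prod.ext ?_ rfl
          simp [q, r, h0, S.aZ_zero hS]
        rw [hqy] at hq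
        exact hq ⟨S.mem_Box_of_fst_eq_zero hS h0, hy⟩
      have hj : ∀ j, m / D * |(y.1 j : ℝ)| ≤ S.phi t y := fun j => by
        rw [hφ]
        exact hinf' (fun i => (y.1 i : ℝ)) j
      refine ⟨?_, hj⟩
      obtain ⟨j, hj0⟩ := Function.ne_iff.1 hy1
      refine le_trans ?_ (hj j)
      refine le_mul_of_one_le_right (by positivity) ?_
      exact_mod_cast Int.one_le_abs hj0
  refine ⟨m / D, by positivity, fun y j => ?_, fun y hy => (hfin y hy).1, hinf'⟩
  by_cases hy : y = 0
  · subst hy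
    simp [S.phi_zero hS]
  · exact (hfin y hy).2 j

end StackyFan
end ToricStack

namespace ToricStack

/-! ### Families of sets of polynomially bounded cardinality -/

/-- The sets `A B`, `B ≥ 1`, are finite and their cardinality is polynomially bounded in `B`. -/
def PolyBounded {α : Type*} (A : ℝ → Set α) : Prop :=
  ∃ (C : ℝ) (m : ℕ), ∀ B : ℝ, 1 ≤ B → (A B).Finite ∧ ((A B).ncard : ℝ) ≤ C * B ^ m

namespace PolyBounded

variable {α β : Type*}

theorem mono {A A' : ℝ → Set α} (h : PolyBounded A') (hA : ∀ B, 1 ≤ B → A B ⊆ A' B) :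
    PolyBounded A := by
  obtain ⟨C, m, h⟩ := h
  refine ⟨C, m, fun B hB => ⟨(h B hB).1.subset (hA B hB), le_trans ?_ (h B hB).2⟩⟩
  exact_mod_cast Set.ncard_le_ncard (hA B hB) (h B hB).1

theorem image {A : ℝ → Set α} (h : PolyBounded A) (f : α → β) :
    PolyBounded (fun B => f '' A B) := by
  obtain ⟨C, m, h⟩ := h
  refine ⟨C, m, fun B hB => ⟨(h B hB).1.image f, le_trans ?_ (h B hB).2⟩⟩
  exact_mod_cast Set.ncard_image_le (h B hB).1

theorem const {s : Set α} (hs : s.Finite) : PolyBounded (fun _ => s) :=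
  ⟨s.ncard, 0, fun B _ => ⟨hs, by simp⟩⟩

theorem comp_mul_pow {A : ℝ → Set α} (h : PolyBounded A) {K : ℝ} (hK : 1 ≤ K) (n : ℕ) :
    PolyBounded (fun B => A (K * B ^ n)) := by
  obtain ⟨C, m, h⟩ := h
  refine ⟨C * K ^ m, n * m, fun B hB => ?_⟩
  have := h (K * B ^ n) (one_le_mul_of_one_le_of_one_le hK (one_le_pow₀ hB))
  rwa [mul_pow, ← pow_mul, ← mul_assoc] at this

theorem prod {A : ℝ → Set α} {A' : ℝ → Set β} (h : PolyBounded A) (h' : PolyBounded A') :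
    PolyBounded (fun B => A B ×ˢ A' B) := by
  obtain ⟨C, m, h⟩ := h
  obtain ⟨C', m', h'⟩ := h'
  refine ⟨C * C', m + m', fun B hB => ⟨(h B hB).1.prod (h' B hB).1, ?_⟩⟩
  rw [Set.ncard_prod, Nat.cast_mul, pow_add, mul_mul_mul_comm]
  exact mul_le_mul (h B hB).2 (h' B hB).2 (Nat.cast_nonneg _)
    ((Nat.cast_nonneg _).trans (h B hB).2)

theorem pi {ι : Type*} [Fintype ι] {α : ι → Type*} {A : ∀ i, ℝ → Set (α i)}
    (h : ∀ i, PolyBounded (A i)) : PolyBounded (fun B => Set.univ.pi fun i => A i B) := by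
  classical
  choose C m h using h
  refine ⟨∏ i, C i, ∑ i, m i, fun B hB => ⟨Set.Finite.pi fun i => (h i B hB).1, ?_⟩⟩
  have hcard : (Set.univ.pi fun i => A i B).ncard = ∏ i, (A i B).ncard := by
    rw [← Nat.card_coe_set_eq, Nat.card_congr (Equiv.Set.univPi fun i => A i B), Nat.card_pi]
    rfl
  rw [hcard, Nat.cast_prod, ← Finset.prod_pow_eq_pow_sum, ← Finset.prod_mul_distrib]
  exact Finset.prod_le_prod (fun i _ => Nat.cast_nonneg _) fun i _ => (h i B hB).2

theorem int_abs_le : PolyBounded (fun B => {n : ℤ | (|n| : ℝ) ≤ B}) := by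
  refine ⟨3, 1, fun B hB => ?_⟩
  have h : {n : ℤ | (|n| : ℝ) ≤ B} = (Finset.Icc (-⌊B⌋) ⌊B⌋ : Finset ℤ) := by
    ext n
    rw [Set.mem_ofPred_eq, Finset.coe_Icc, Set.mem_Icc, ← abs_le, Int.le_floor]
    push_cast
    rfl
  simp only [h]
  refine ⟨Finset.finite_toSet _, ?_⟩
  rw [Set.ncard_coe_finset, Int.card_Icc]
  have h0 : 0 ≤ ⌊B⌋ := Int.floor_nonneg.2 (zero_le_one.trans hB)
  have h1 : ((⌊B⌋ + 1 - -⌊B⌋).toNat : ℤ) = 2 * ⌊B⌋ + 1 := by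
    rw [Int.toNat_of_nonneg (by linarith)]
    ring
  have h2 : ((⌊B⌋ + 1 - -⌊B⌋).toNat : ℝ) = 2 * ⌊B⌋ + 1 := by exact_mod_cast h1
  rw [h2]
  linarith [Int.floor_le B]

theorem exists_polynomial {A : ℝ → Set α} (h : PolyBounded A) (hA : Monotone A) :
    ∃ P : Polynomial ℝ, ∀ B : ℝ, 0 ≤ B → (A B).Finite ∧ ((A B).ncard : ℝ) ≤ P.eval B := by
  obtain ⟨C, m, h⟩ := h
  refine ⟨Polynomial.C C * (Polynomial.X + 1) ^ m, fun B hB => ?_⟩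
  have h1 := h (B + 1) (by linarith)
  -- The bound is only available from `1` on; the shift covers `0 ≤ B < 1`.
  have hsub : A B ⊆ A (B + 1) := hA (by linarith)
  refine ⟨h1.1.subset hsub, le_trans ?_ (h1.2.trans_eq (by simp))⟩
  exact_mod_cast Set.ncard_le_ncard hsub h1.1

end PolyBounded

/-! ### Counting in number fields -/

section NumberField

variable (F : Type*) [Field F] [NumberField F]

/-- Coordinates in an integral basis are bounded by a constant times the house, so this reduces to
counting integer vectors in a box. -/
theorem polyBounded_integers :
    PolyBounded (fun B => {α : 𝓞 F | ∀ w : InfinitePlace F, w (α : F) ≤ B}) := by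
  classical
  obtain ⟨c, hc⟩ : ∃ c : ℝ, ∀ (α : 𝓞 F) (i : F →+* ℂ),
      ‖(((integralBasis F).reindex (equivReindex F).symm).repr α i : ℂ)‖ ≤ c * house (α : F) :=
    ⟨_, fun α i => house.basis_repr_norm_le_const_mul_house F α i⟩
  have hrepr : ∀ (α : 𝓞 F) (i : F →+* ℂ),
      ‖(((integralBasis F).reindex (equivReindex F).symm).repr α i : ℂ)‖ =
        |(((RingOfIntegers.basis F).repr α (equivReindex F i) : ℤ) : ℝ)| := by
    intro α i
    rw [Module.Basis.repr_reindex_apply, Equiv.symm_symm, integralBasis_repr_apply]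
    simp
  have hhouse : ∀ (α : F) (B : ℝ), 0 ≤ B → (∀ w : InfinitePlace F, w α ≤ B) → house α ≤ B := by
    intro α B hB h
    refine (pi_norm_le_iff_of_nonneg hB).2 fun φ => ?_
    exact h (InfinitePlace.mk φ)
  refine PolyBounded.mono (((PolyBounded.pi fun _ : Module.Free.ChooseBasisIndex ℤ (𝓞 F) =>
    PolyBounded.int_abs_le).comp_mul_pow (le_max_right c 1) 1).image
      fun m => ∑ i, m i • RingOfIntegers.basis F i) fun B hB α hα => ?_
  refine ⟨fun i => (RingOfIntegers.basis F).repr α i, fun i _ => ?_,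
    (RingOfIntegers.basis F).sum_repr α⟩
  have h1 := hc α ((equivReindex F).symm i)
  rw [hrepr, Equiv.apply_symm_apply] at h1
  refine h1.trans ?_
  rw [pow_one]
  exact mul_le_mul (le_max_left _ _) (hhouse _ _ (by linarith) hα) (norm_nonneg _)
    (zero_le_one.trans (le_max_right _ _))

theorem polyBounded_ideals :
    PolyBounded (fun B => {I : Ideal (𝓞 F) | (Ideal.absNorm I : ℝ) ≤ B}) := by
  have hfin : ∀ B : ℝ, 0 ≤ B → {I : Ideal (𝓞 F) | (Ideal.absNorm I : ℝ) ≤ B}.Finite := by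
    intro B hB
    refine (Ideal.finite_setOfPred_absNorm_le (S := 𝓞 F) ⌊B⌋₊).subset fun I hI => ?_
    exact Nat.le_floor hI
  have hlim := NumberField.Ideal.tendsto_norm_le_div_atTop F
  obtain ⟨L, hL⟩ : ∃ L : ℝ, ∀ᶠ s : ℝ in Filter.atTop,
      (Nat.card {I : Ideal (𝓞 F) // (Ideal.absNorm I : ℝ) ≤ s} : ℝ) / s ≤ L :=
    ⟨_, hlim.eventually_le_const (lt_add_one _)⟩
  obtain ⟨s₀, hs₀⟩ := Filter.eventually_atTop.1 hL
  -- The ideal-counting limit bounds the ratio only beyond `s₀`; counting up to `M * B` reaches that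
  -- range for every `B ≥ 1`.
  set M := max s₀ 1 with hM
  have hM1 : 1 ≤ M := le_max_right _ _
  refine ⟨L * M, 1, fun B hB => ⟨hfin B (zero_le_one.trans hB), ?_⟩⟩
  have hMB : s₀ ≤ M * B := (le_max_left _ _).trans (le_mul_of_one_le_right (by linarith) hB)
  have h1 := hs₀ (M * B) hMB
  have hpos : 0 < M * B := by positivity
  rw [div_le_iff₀ hpos] at h1
  rw [pow_one, mul_assoc]
  refine le_trans ?_ h1
  have : {I : Ideal (𝓞 F) | (Ideal.absNorm I : ℝ) ≤ B} ⊆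
      {I : Ideal (𝓞 F) | (Ideal.absNorm I : ℝ) ≤ M * B} := fun I hI =>
    le_trans hI (le_mul_of_one_le_left (by linarith) hM1)
  have := Set.ncard_le_ncard this (hfin _ hpos.le)
  rw [← Nat.card_coe_set_eq (s := {I : Ideal (𝓞 F) | (Ideal.absNorm I : ℝ) ≤ M * B})] at this
  exact_mod_cast this

variable {F}

/-- The normalized valuation at a finite place, on `Fˣ`. -/
noncomputable def ordF (v : HeightOneSpectrum (𝓞 F)) (x : Fˣ) : ℤ := -(v.valuationOfNeZero x).toAdd

theorem valuation_eq_exp_neg_ordF (v : HeightOneSpectrum (𝓞 F)) (x : Fˣ) :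
    v.valuation F (x : F) = WithZero.exp (-ordF v x) := by
  rw [← HeightOneSpectrum.valuationOfNeZero_eq]
  simp [ordF, WithZero.exp]

theorem ordF_mul (v : HeightOneSpectrum (𝓞 F)) (x y : Fˣ) :
    ordF v (x * y) = ordF v x + ordF v y := by
  simp [ordF, add_comm]

theorem ordF_one (v : HeightOneSpectrum (𝓞 F)) : ordF v 1 = 0 := by
  simp [ordF]

theorem finite_ordF_ne_zero (x : Fˣ) : {v : HeightOneSpectrum (𝓞 F) | ordF v x ≠ 0}.Finite := by
  refine ((HeightOneSpectrum.Support.finite (𝓞 F) (x : F)).union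
    (HeightOneSpectrum.Support.finite (𝓞 F) ((x⁻¹ : Fˣ) : F))).subset fun v hv => ?_
  have h1 := ordF_mul v x x⁻¹
  rw [mul_inv_cancel, ordF_one] at h1
  simp only [HeightOneSpectrum.Support, Set.mem_union, Set.mem_ofPred_eq,
    valuation_eq_exp_neg_ordF, ← WithZero.exp_zero, WithZero.exp_lt_exp]
  have : ordF v x ≠ 0 := hv
  omega

theorem ord_map (v : HeightOneSpectrum (𝓞 F)) (x : Fˣ) :
    (ord v (Units.map (algebraMap F (v.adicCompletion F) : F →* v.adicCompletion F) x)).toAdd =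
      ordF v x := by
  have h : (WithZero.unitsWithZeroEquiv (Units.map
      (Valued.v (R := v.adicCompletion F)).toMonoidWithZeroHom.toMonoidHom
      (Units.map (algebraMap F (v.adicCompletion F) : F →* v.adicCompletion F) x))) =
      v.valuationOfNeZero x := by
    rw [← WithZero.coe_inj, HeightOneSpectrum.valuationOfNeZero_eq,
      ← HeightOneSpectrum.valuedAdicCompletion_eq_valuation']
    exact WithZero.coe_unitsWithZeroEquiv_eq_units_val _
  have h' : ord v (Units.map (algebraMap F (v.adicCompletion F) : F →* v.adicCompletion F) x) =
      (v.valuationOfNeZero x)⁻¹ := by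
    rw [← h]
    rfl
  rw [h']
  rfl

theorem logBMu_map (n : ℕ) (v : HeightOneSpectrum (𝓞 F)) (x : Fˣ) :
    (logBMu n v (BMu.map n (algebraMap F (v.adicCompletion F)) (x : BMu n F))).toAdd =
      (ordF v x : ZMod n) := by
  rw [← ord_map]
  rfl

/-- The composition of `Bμ_n(F) → Bμ_n(F_v)` with `log_{Bμ_n, v}`. -/
noncomputable def ordMod (n : ℕ) (v : HeightOneSpectrum (𝓞 F)) (z : BMu n F) : ZMod n :=
  (logBMu n v (BMu.map n (algebraMap F (v.adicCompletion F)) z)).toAdd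

theorem ordMod_mk (n : ℕ) (v : HeightOneSpectrum (𝓞 F)) (x : Fˣ) :
    ordMod n v (x : BMu n F) = (ordF v x : ZMod n) :=
  logBMu_map n v x

theorem ordMod_mul (n : ℕ) (v : HeightOneSpectrum (𝓞 F)) (z w : BMu n F) :
    ordMod n v (z * w) = ordMod n v z + ordMod n v w := by
  simp [ordMod]

theorem ordMod_inv (n : ℕ) (v : HeightOneSpectrum (𝓞 F)) (z : BMu n F) :
    ordMod n v z⁻¹ = -ordMod n v z := by
  simp [ordMod]

theorem finite_ordMod_ne_zero (n : ℕ) (z : BMu n F) :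
    {v : HeightOneSpectrum (𝓞 F) | ordMod n v z ≠ 0}.Finite := by
  obtain ⟨x, rfl⟩ := QuotientGroup.mk_surjective z
  refine (finite_ordF_ne_zero x).subset fun v hv h => hv ?_
  rw [ordMod_mk, h, Int.cast_zero]

theorem one_lt_absNorm (v : HeightOneSpectrum (𝓞 F)) : 1 < Ideal.absNorm v.asIdeal := by
  have h0 : Ideal.absNorm v.asIdeal ≠ 0 := Ideal.absNorm_eq_zero_iff.not.2 v.ne_bot
  have h1 : Ideal.absNorm v.asIdeal ≠ 1 := Ideal.absNorm_eq_one_iff.not.2 v.isPrime.ne_top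
  omega

/-- Units of `F` whose finite and infinite local heights are bounded. -/
theorem polyBounded_units :
    PolyBounded (fun B => {x : Fˣ |
      ((∏ᶠ v : HeightOneSpectrum (𝓞 F), Ideal.absNorm v.asIdeal ^ (ordF v x).natAbs : ℕ) : ℝ) ≤ B ∧
      ∀ w : InfinitePlace F, w (x : F) ≤ B}) := by
  classical
  let f : ℤ × 𝓞 F → Fˣ := fun p =>
    if h : (p.2 : F) / (p.1 : F) ≠ 0 then Units.mk0 _ h else 1
  -- The exponent `2` arises because `n * x` has archimedean absolute values at most `B * B`.
  refine PolyBounded.mono ((PolyBounded.int_abs_le.prod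
    ((polyBounded_integers F).comp_mul_pow le_rfl 2)).image f) ?_
  rintro B hB x ⟨hx1, hx2⟩
  set n : ℕ := ∏ᶠ v : HeightOneSpectrum (𝓞 F), Ideal.absNorm v.asIdeal ^ (ordF v x).natAbs with hn
  have hsupp : (Function.mulSupport fun v : HeightOneSpectrum (𝓞 F) =>
      Ideal.absNorm v.asIdeal ^ (ordF v x).natAbs).Finite := by
    refine (finite_ordF_ne_zero x).subset fun v hv h => hv ?_
    simp [h]
  have hn0 : n ≠ 0 := by
    rw [hn, finprod_eq_prod _ hsupp]
    exact Finset.prod_ne_zero_iff.2 fun v _ => pow_ne_zero _ (by have := one_lt_absNorm v; omega)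
  have hnF : (n : F) ≠ 0 := Nat.cast_ne_zero.2 hn0
  have hval : ∀ v : HeightOneSpectrum (𝓞 F), v.valuation F ((n : F) * x) ≤ 1 := by
    -- `n` clears denominators: the norm of `v` lies in `v`, so `n` lies in `v ^ |ord_v x|`.
    intro v
    have hmem : (n : 𝓞 F) ∈ v.asIdeal ^ (ordF v x).natAbs := by
      have hdvd : Ideal.absNorm v.asIdeal ^ (ordF v x).natAbs ∣ n := finprod_mem_dvd v hsupp
      obtain ⟨q, hq⟩ := hdvd
      rw [hq, Nat.cast_mul, Nat.cast_pow]
      exact Ideal.mul_mem_right _ _ (Ideal.pow_mem_pow (Ideal.absNorm_mem _) _)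
    have hle := (v.intValuation_le_pow_iff_mem _ _).2 hmem
    have hnv : v.valuation F (n : F) ≤ WithZero.exp (-((ordF v x).natAbs : ℤ)) := by
      rw [← HeightOneSpectrum.valuation_of_algebraMap (K := F)] at hle
      simpa using hle
    rw [map_mul, valuation_eq_exp_neg_ordF]
    calc _ ≤ WithZero.exp (-((ordF v x).natAbs : ℤ)) * WithZero.exp (-ordF v x) := by gcongr
      _ ≤ 1 := by
        rw [← WithZero.exp_add, ← WithZero.exp_zero, WithZero.exp_le_exp]
        omega
  obtain ⟨α, hα⟩ := HeightOneSpectrum.mem_integers_of_valuation_le_one F ((n : F) * x) hval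
  refine ⟨((n : ℤ), α), ⟨?_, ?_⟩, ?_⟩
  · simpa using hx1
  · intro w
    change w (algebraMap (𝓞 F) F α) ≤ _
    rw [hα, map_mul, one_mul, sq, InfinitePlace.map_natCast]
    exact mul_le_mul hx1 (hx2 w) (apply_nonneg w _) (by linarith)
  · have hdiv : (α : F) / (((n : ℤ) : ℤ) : F) = x := by
      change algebraMap (𝓞 F) F α / _ = _
      rw [hα, Int.cast_natCast, mul_div_cancel_left₀ _ hnF]
    have h0 : (α : F) / (((n : ℤ) : ℤ) : F) ≠ 0 := hdiv ▸ x.ne_zero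
    simp only [f]
    rw [dif_pos h0]
    exact Units.ext hdiv

end NumberField

end ToricStack

namespace ToricStack

/-! ### Classes modulo `n`-th powers: the finite kernel and the associated ideal -/

section Kummer

variable {F : Type*} [Field F] [NumberField F]

theorem exists_pow_eq_of_dvd_count {R : Type*} [CommRing R] [IsDedekindDomain R] {I : Ideal R}
    (hI : I ≠ 0) {n : ℕ}
    (h : ∀ v : HeightOneSpectrum R, n ∣ (Associates.mk v.asIdeal).count (Associates.mk I).factors) :
    ∃ J : Ideal R, J ^ n = I := by
  refine ⟨∏ᶠ v : HeightOneSpectrum R,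
    v.asIdeal ^ ((Associates.mk v.asIdeal).count (Associates.mk I).factors / n), ?_⟩
  rw [finprod_pow]
  · refine (finprod_congr fun v => ?_).trans (Ideal.finprod_heightOneSpectrum_factorization hI)
    rw [← pow_mul, Nat.div_mul_cancel (h v)]
    rfl
  · refine (Filter.eventually_cofinite.1 (Associates.finite_factors hI)).subset fun v hv h0 => hv ?_
    have h0' : (Associates.mk v.asIdeal).count (Associates.mk I).factors = 0 := by exact_mod_cast h0
    simp [h0']

theorem exists_integer_representative (n : ℕ) (hn : 0 < n) (z : BMu n F) :
    ∃ (α : 𝓞 F) (x : Fˣ), (x : F) = α ∧ (x : BMu n F) = z := by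
  obtain ⟨x, rfl⟩ := QuotientGroup.mk_surjective z
  obtain ⟨α, β, hβ, hx⟩ := IsFractionRing.div_surjective (A := 𝓞 F) (x : F)
  have hβ0 : (β : F) ≠ 0 := by
    have := nonZeroDivisors.ne_zero hβ
    exact_mod_cast this
  -- Multiplying `α / β` by `β ^ n` keeps the class and clears the denominator.
  refine ⟨α * β ^ (n - 1), x * Units.mk0 (β : F) hβ0 ^ n, ?_, ?_⟩
  · simp only [Units.val_mul, Units.val_pow_eq_pow_val, Units.val_mk0, map_mul, map_pow]
    rw [← hx]
    obtain ⟨m, rfl⟩ : ∃ m, n = m + 1 := ⟨n - 1, by omega⟩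
    rw [Nat.add_sub_cancel, pow_succ]
    field_simp
  · refine (QuotientGroup.eq).2 ?_
    exact ⟨(Units.mk0 (β : F) hβ0)⁻¹, by simp⟩

theorem ordF_eq_count (v : HeightOneSpectrum (𝓞 F)) {α : 𝓞 F} {x : Fˣ}
    (hx : (x : F) = α) :
    ordF v x = (Associates.mk v.asIdeal).count (Associates.mk (Ideal.span {α})).factors := by
  have hα : α ≠ 0 := by
    rintro rfl
    simp at hx
  have h := valuation_eq_exp_neg_ordF v x
  rw [hx, HeightOneSpectrum.valuation_of_algebraMap, HeightOneSpectrum.intValuation_if_neg _ hα] at h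
  have := WithZero.exp_injective h
  omega

/-- The image of the units of `𝓞 F` in `Fˣ / (Fˣ)^n`. -/
noncomputable def unitsToBMu (F : Type*) [Field F] [NumberField F] (n : ℕ) : (𝓞 F)ˣ →* BMu n F :=
  (QuotientGroup.mk' _).comp (Units.map (algebraMap (𝓞 F) F : 𝓞 F →* F))

/-- The unit group is finitely generated, and a finitely generated abelian group killed by `n` is
finite. -/
theorem finite_range_unitsToBMu (n : ℕ) (hn : 0 < n) :
    (Set.range (unitsToBMu F n)).Finite := by
  have : Group.FG (𝓞 F)ˣ := Group.fg_iff_monoid_fg.2 inferInstance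
  have hfg : Group.FG (unitsToBMu F n).range := Group.fg_range _
  have : Finite (unitsToBMu F n).range := by
    apply CommGroup.finite_of_fg_isMulTorsion
    rintro ⟨_, u, rfl⟩
    refine isOfFinOrder_iff_pow_eq_one.2 ⟨n, hn, Subtype.ext ?_⟩
    refine (QuotientGroup.eq_one_iff _).2 ?_
    exact ⟨Units.map (algebraMap (𝓞 F) F : 𝓞 F →* F) u, rfl⟩
  exact Set.toFinite ((unitsToBMu F n).range : Set (BMu n F))

/-- Finiteness of the group of classes whose valuations are all divisible by `n`. -/
theorem finite_ordMod_eq_zero (n : ℕ) (hn : 0 < n) :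
    {z : BMu n F | ∀ v : HeightOneSpectrum (𝓞 F), ordMod n v z = 0}.Finite := by
  classical
  set K := {z : BMu n F | ∀ v : HeightOneSpectrum (𝓞 F), ordMod n v z = 0}
  have key : ∀ z : K, ∃ (α : 𝓞 F) (x : Fˣ) (J : nonZeroDivisors (Ideal (𝓞 F))),
      (x : F) = α ∧ (x : BMu n F) = z.1 ∧ (J : Ideal (𝓞 F)) ^ n = Ideal.span {α} := by
    rintro ⟨z, hz⟩
    obtain ⟨α, x, hx, rfl⟩ := exists_integer_representative n hn z
    have hα : α ≠ 0 := by
      rintro rfl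
      simp at hx
    have hI : Ideal.span {α} ≠ 0 := by simpa using hα
    obtain ⟨J, hJ⟩ := exists_pow_eq_of_dvd_count hI fun v => by
      have := hz v
      rw [ordMod_mk, ZMod.intCast_zmod_eq_zero_iff_dvd, ordF_eq_count v hx] at this
      exact_mod_cast this
    have hJ0 : J ≠ 0 := by
      rintro rfl
      exact hI (by rw [← hJ, zero_pow hn.ne'])
    exact ⟨α, x, ⟨J, mem_nonZeroDivisors_of_ne_zero hJ0⟩, hx, rfl, hJ⟩
  choose α x J hx hz hJ using key
  -- One chosen class per ideal class of the `n`-th root `J` of `(α)`; the value `1` is a default.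
  let s : ClassGroup (𝓞 F) → BMu n F := fun c =>
    if h : ∃ z : K, ClassGroup.mk0 (J z) = c then h.choose.1 else 1
  refine ((Set.finite_univ (α := ClassGroup (𝓞 F))).prod (finite_range_unitsToBMu (F := F) n hn)
    |>.image fun p => s p.1 * p.2).subset fun z hzK => ?_
  set z' : K := ⟨z, hzK⟩
  have hex : ∃ w : K, ClassGroup.mk0 (J w) = ClassGroup.mk0 (J z') := ⟨z', rfl⟩
  have hs : s (ClassGroup.mk0 (J z')) = hex.choose.1 := dif_pos hex
  have hw := hex.choose_spec
  set w : K := hex.choose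
  obtain ⟨a, b, ha, hb, hab⟩ := ClassGroup.mk0_eq_mk0_iff.1 hw
  -- Raise `(a) J_w = (b) J_z'` to the `n`-th power: the generators differ by a unit `u`, so `z` is
  -- the class of `α_w * u` modulo `n`-th powers.
  have hab' : Ideal.span {a ^ n * α w} = Ideal.span {b ^ n * α z'} := by
    rw [← Ideal.span_singleton_mul_span_singleton, ← Ideal.span_singleton_mul_span_singleton,
      ← Ideal.span_singleton_pow, ← Ideal.span_singleton_pow, ← hJ, ← hJ, ← mul_pow, ← mul_pow, hab]
  obtain ⟨u, hu⟩ := Ideal.span_singleton_eq_span_singleton.1 hab'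
  refine ⟨(ClassGroup.mk0 (J z'), unitsToBMu F n u), ⟨trivial, u, rfl⟩, ?_⟩
  change s (ClassGroup.mk0 (J z')) * unitsToBMu F n u = z
  rw [hs, show z = z'.1 from rfl, ← hz w, ← hz z']
  have haF : (a : F) ≠ 0 := by exact_mod_cast ha
  have hbF : (b : F) ≠ 0 := by exact_mod_cast hb
  refine (QuotientGroup.eq (s := (powMonoidHom n : Fˣ →* Fˣ).range)
    (a := x w * Units.map (algebraMap (𝓞 F) F : 𝓞 F →* F) u) (b := x z')).2 ?_
  refine ⟨Units.mk0 (a : F) haF * (Units.mk0 (b : F) hbF)⁻¹, ?_⟩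
  rw [eq_inv_mul_iff_mul_eq]
  have hF := congrArg (algebraMap (𝓞 F) F) hu
  simp only [map_mul, map_pow] at hF
  rw [show algebraMap (𝓞 F) F (α w) = x w from (hx w).symm,
    show algebraMap (𝓞 F) F (α z') = x z' from (hx z').symm] at hF
  simp only [powMonoidHom_apply, mul_pow, inv_pow]
  rw [← mul_assoc, mul_inv_eq_iff_eq_mul]
  apply Units.ext
  simp only [Units.val_mul, Units.val_pow_eq_pow_val, Units.val_mk0, Units.coe_map,
    MonoidHom.coe_coe]
  linear_combination hF

/-- The integral ideal `∏_v v ^ r_v`, where `0 ≤ r_v < n` represents `ord_v` modulo `n`. -/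
noncomputable def idealOfBMu (n : ℕ) (z : BMu n F) : Ideal (𝓞 F) :=
  ∏ᶠ v : HeightOneSpectrum (𝓞 F), v.asIdeal ^ (ordMod n v z).val

theorem finite_mulSupport_idealOfBMu (n : ℕ) (z : BMu n F) :
    (Function.mulSupport fun v : HeightOneSpectrum (𝓞 F) =>
      v.asIdeal ^ (ordMod n v z).val).Finite := by
  refine (finite_ordMod_ne_zero n z).subset fun v hv h => hv ?_
  simp [h]

/-- The multiplicity of `v` in the ideal is the chosen representative of `ord_v` in `[0, n)`, which
determines the residue. -/
theorem ordMod_eq_of_idealOfBMu_eq (n : ℕ) (hn : 0 < n) {z w : BMu n F}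
    (h : idealOfBMu n z = idealOfBMu n w) (v : HeightOneSpectrum (𝓞 F)) :
    ordMod n v z = ordMod n v w := by
  have : NeZero n := ⟨hn.ne'⟩
  have key : ∀ z : BMu n F, FractionalIdeal.count F v
      (idealOfBMu n z : FractionalIdeal (nonZeroDivisors (𝓞 F)) F) = (ordMod n v z).val := by
    intro z
    have hcoe : (idealOfBMu n z : FractionalIdeal (nonZeroDivisors (𝓞 F)) F) =
        ∏ᶠ v : HeightOneSpectrum (𝓞 F),
          (v.asIdeal : FractionalIdeal (nonZeroDivisors (𝓞 F)) F) ^ ((ordMod n v z).val : ℤ) := by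
      have := MonoidHom.map_finprod
        (FractionalIdeal.coeIdealHom (nonZeroDivisors (𝓞 F)) F).toMonoidHom
        (finite_mulSupport_idealOfBMu n z)
      refine this.trans (finprod_congr fun v => ?_)
      rw [zpow_natCast]
      exact map_pow (FractionalIdeal.coeIdealHom (nonZeroDivisors (𝓞 F)) F) v.asIdeal _
    rw [hcoe, FractionalIdeal.count_finprod F v (fun v => ((ordMod n v z).val : ℤ))]
    refine (finite_ordMod_ne_zero n z).subset fun v hv h => hv ?_
    simp [h]
  have h1 := key z
  rw [h, key w] at h1
  exact (ZMod.val_injective n (by exact_mod_cast h1)).symm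

theorem absNorm_idealOfBMu_le (n : ℕ) (hn : 0 < n) (z : BMu n F) :
    Ideal.absNorm (idealOfBMu n z) ≤ (∏ᶠ v : HeightOneSpectrum (𝓞 F),
      open Classical in if ordMod n v z = 0 then 1 else Ideal.absNorm v.asIdeal) ^ n := by
  classical
  have : NeZero n := ⟨hn.ne'⟩
  have hT := finite_ordMod_ne_zero n z
  rw [idealOfBMu, finprod_eq_finsetProd_of_mulSupport_subset (s := hT.toFinset),
    finprod_eq_finsetProd_of_mulSupport_subset (s := hT.toFinset), map_prod, ← Finset.prod_pow]
  · refine Finset.prod_le_prod' fun v hv => ?_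
    rw [if_neg (hT.mem_toFinset.1 hv), map_pow]
    exact pow_le_pow_right₀ (one_lt_absNorm v).le (ZMod.val_lt _).le
  · intro v hv
    rw [Set.Finite.coe_toFinset]
    exact fun h => hv (if_pos h)
  · intro v hv
    rw [Set.Finite.coe_toFinset]
    exact fun h => hv (by simp [h])

/-- Classes modulo `n`-th powers that ramify only at primes whose product has bounded norm. -/
theorem polyBounded_BMu (n : ℕ) (hn : 0 < n) :
    PolyBounded (fun B => {z : BMu n F | ((∏ᶠ v : HeightOneSpectrum (𝓞 F),
      open Classical in if ordMod n v z = 0 then 1 else Ideal.absNorm v.asIdeal : ℕ) : ℝ) ≤ B}) := by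
  classical
  let s : Ideal (𝓞 F) → BMu n F := fun I =>
    if h : ∃ z : BMu n F, idealOfBMu n z = I then h.choose else 1
  refine PolyBounded.mono ((((polyBounded_ideals F).comp_mul_pow le_rfl n).prod
    (PolyBounded.const (finite_ordMod_eq_zero (F := F) n hn))).image fun p => s p.1 * p.2) ?_
  intro B hB z hz
  have hex : ∃ w : BMu n F, idealOfBMu n w = idealOfBMu n z := ⟨z, rfl⟩
  have hs : s (idealOfBMu n z) = hex.choose := dif_pos hex
  -- Two classes with the same ideal differ by an element all of whose residues vanish.
  refine ⟨(idealOfBMu n z, (hex.choose)⁻¹ * z), ⟨?_, fun v => ?_⟩, ?_⟩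
  · change (Ideal.absNorm (idealOfBMu n z) : ℝ) ≤ 1 * B ^ n
    rw [one_mul]
    refine le_trans ?_ (pow_le_pow_left₀ (Nat.cast_nonneg _) hz n)
    exact_mod_cast absNorm_idealOfBMu_le n hn z
  · rw [ordMod_mul, ordMod_inv, ordMod_eq_of_idealOfBMu_eq n hn hex.choose_spec v,
      neg_add_cancel]
  · change s (idealOfBMu n z) * _ = z
    rw [hs, mul_inv_cancel_left]

end Kummer

end ToricStack

namespace ToricStack

/-! ### From bounded height to bounded coordinates -/

namespace StackyFan

variable {N : Type*} [AddCommGroup N] {d k : ℕ} {ℓ : Fin k → ℕ} {e : N ≃+ Cochar d ℓ}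
  (S : StackyFan e) {F : Type*} [Field F] [NumberField F]

theorem logFin_map (v : HeightOneSpectrum (𝓞 F)) (x : TorusPoints d ℓ F) :
    logFin v (x.map (algebraMap F (v.adicCompletion F))) =
      (fun j => ordF v (x.1 j), fun i => ordMod (ℓ i) v (x.2 i)) :=
  Prod.ext (funext fun j => ord_map v (x.1 j)) rfl

theorem finite_logFin_map_ne_zero (x : TorusPoints d ℓ F) :
    {v : HeightOneSpectrum (𝓞 F) |
      logFin v (x.map (algebraMap F (v.adicCompletion F))) ≠ 0}.Finite := by
  refine ((Set.finite_iUnion fun j => finite_ordF_ne_zero (x.1 j)).union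
    (Set.finite_iUnion fun i => finite_ordMod_ne_zero (ℓ i) (x.2 i))).subset fun v hv => ?_
  by_contra h
  simp only [Set.mem_union, Set.mem_iUnion, Set.mem_ofPred_eq, not_or, not_exists, not_not] at h
  apply hv
  rw [logFin_map]
  exact Prod.ext (funext h.1) (funext h.2)

theorem logInf_map {K : Type*} [Field K] (w : InfinitePlace K) (x : TorusPoints d ℓ K) (j : Fin d) :
    logInf w (x.map (algebraMap K w.Completion)) j = -Real.log (w (x.1 j : K)) :=
  congrArg (fun r => -Real.log r)
    (InfinitePlace.Completion.norm_coe w ((WithAbs.equiv w.1).symm (x.1 j : K)))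

variable {S} {t : S.Param} {c : ℝ}

theorem phi_nonneg (hS : S.IsComplete) (hc : 0 < c) (h1 : ∀ y : Cochar d ℓ, y ≠ 0 → c ≤ S.phi t y)
    (y : Cochar d ℓ) : 0 ≤ S.phi t y := by
  by_cases hy : y = 0
  · rw [hy, S.phi_zero hS]
  · exact hc.le.trans (h1 y hy)

theorem one_le_localHeightFin (hφ : ∀ y : Cochar d ℓ, 0 ≤ S.phi t y)
    (v : HeightOneSpectrum (𝓞 F)) (x : TorusPoints d ℓ (v.adicCompletion F)) :
    1 ≤ S.localHeightFin v t x :=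
  Real.one_le_exp (mul_nonneg (Real.log_nonneg (by exact_mod_cast (one_lt_absNorm v).le)) (hφ _))

/-- Both products are supported on the finite set of places with nonzero `logFin`, so local
inequalities multiply. -/
theorem natCast_finprod_rpow_le (hS : S.IsComplete)
    (x : TorusPoints d ℓ F) (g : HeightOneSpectrum (𝓞 F) → ℕ)
    (hg : ∀ v, (g v : ℝ) ^ c ≤ S.localHeightFin v t (x.map (algebraMap F (v.adicCompletion F))))
    (hg1 : ∀ v, logFin v (x.map (algebraMap F (v.adicCompletion F))) = 0 → g v = 1) :
    ((∏ᶠ v, g v : ℕ) : ℝ) ^ c ≤ ∏ᶠ v : HeightOneSpectrum (𝓞 F),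
      S.localHeightFin v t (x.map (algebraMap F (v.adicCompletion F))) := by
  have hT := finite_logFin_map_ne_zero x
  rw [finprod_eq_finsetProd_of_mulSupport_subset (s := hT.toFinset),
    finprod_eq_finsetProd_of_mulSupport_subset (s := hT.toFinset), Nat.cast_prod,
    ← Real.finsetProd_rpow _ _ fun _ _ => Nat.cast_nonneg _]
  · exact Finset.prod_le_prod (fun v _ => Real.rpow_nonneg (Nat.cast_nonneg _) _) fun v _ => hg v
  · intro v hv
    rw [Set.Finite.coe_toFinset]
    refine fun h => hv ?_
    simp [localHeightFin, h, S.phi_zero hS]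
  · intro v hv
    rw [Set.Finite.coe_toFinset]
    exact fun h => hv (hg1 v h)

theorem le_pow_of_rpow_le {a B : ℝ} (hc : 0 < c) (ha : 0 ≤ a) (hB : 1 ≤ B) (h : a ^ c ≤ B) :
    a ≤ 1 * B ^ ⌈c⁻¹⌉₊ := by
  rw [one_mul, ← Real.rpow_natCast]
  calc a = (a ^ c) ^ c⁻¹ := (Real.rpow_rpow_inv ha hc.ne').symm
    _ ≤ B ^ c⁻¹ := Real.rpow_le_rpow (Real.rpow_nonneg ha _) h (inv_nonneg.2 hc.le)
    _ ≤ B ^ ((⌈c⁻¹⌉₊ : ℕ) : ℝ) := Real.rpow_le_rpow_of_exponent_le hB (Nat.le_ceil _)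

theorem polyBounded_height (hℓ : ∀ i, 0 < ℓ i) (hS : S.IsComplete) (ht : t ∈ S.LamInt) :
    PolyBounded (fun B => {x : TorusPoints d ℓ F | S.height t x ≤ B}) := by
  classical
  obtain ⟨c, hc, hy, hy0, hinf⟩ := S.exists_phi_lower_bound hℓ hS ht
  have hφ := phi_nonneg hS hc hy0
  refine PolyBounded.mono ((PolyBounded.pi fun _ : Fin d =>
    (polyBounded_units (F := F)).comp_mul_pow le_rfl ⌈c⁻¹⌉₊).prod
    (PolyBounded.pi fun i : Fin k =>
      (polyBounded_BMu (F := F) (ℓ i) (hℓ i)).comp_mul_pow le_rfl ⌈c⁻¹⌉₊)) ?_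
  intro B hB x hx
  set HF := ∏ᶠ v : HeightOneSpectrum (𝓞 F),
    S.localHeightFin v t (x.map (algebraMap F (v.adicCompletion F))) with hHF
  set HI := ∏ w : InfinitePlace F, S.localHeightInf w t (x.map (algebraMap F w.Completion)) with hHI
  have hH : HF * HI ≤ B := hx
  have hlogN : ∀ v : HeightOneSpectrum (𝓞 F), 0 < Real.log (Ideal.absNorm v.asIdeal) := fun v =>
    Real.log_pos (by exact_mod_cast one_lt_absNorm v)
  have hNpos : ∀ v : HeightOneSpectrum (𝓞 F), (0 : ℝ) < Ideal.absNorm v.asIdeal := fun v => by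
    exact_mod_cast (zero_lt_one.trans (one_lt_absNorm v))
  have hHF1 : 1 ≤ HF := one_le_finprod fun v => one_le_localHeightFin hφ v _
  have hpinf : ∀ z : Fin d → ℝ, 0 ≤ S.phiInf t z := by
    intro z
    refine Finset.sum_nonneg fun ρ _ => mul_nonneg (S.a_nonneg z ρ) ?_
    exact (S.Xi_pos_of_mem_LamInt ht (.inl ρ)).le
  have hloc1 : ∀ w : InfinitePlace F,
      1 ≤ S.localHeightInf w t (x.map (algebraMap F w.Completion)) := fun w =>
    Real.one_le_exp (mul_nonneg (Nat.cast_nonneg _) (hpinf _))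
  have hHI1 : 1 ≤ HI := Finset.one_le_prod fun w _ => hloc1 w
  have hHFB : HF ≤ B := (le_mul_of_one_le_right (by linarith) hHI1).trans hH
  have hHIB : HI ≤ B := (le_mul_of_one_le_left (by linarith) hHF1).trans hH
  refine ⟨fun j _ => ⟨?_, fun w => ?_⟩, fun i _ => ?_⟩
  · refine le_pow_of_rpow_le hc (Nat.cast_nonneg _) hB ((natCast_finprod_rpow_le hS x
      (fun v => Ideal.absNorm v.asIdeal ^ (ordF v (x.1 j)).natAbs) (fun v => ?_)
      (fun v hv => ?_)).trans hHFB)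
    · have h1 := hy (logFin v (x.map (algebraMap F (v.adicCompletion F)))) j
      rw [Nat.cast_pow, ← Real.rpow_natCast, ← Real.rpow_mul (hNpos v).le,
        Real.rpow_def_of_pos (hNpos v)]
      refine Real.exp_le_exp.2 (mul_le_mul_of_nonneg_left (le_trans (le_of_eq ?_) h1) (hlogN v).le)
      rw [logFin_map, mul_comm, Nat.cast_natAbs, Int.cast_abs]
    · rw [logFin_map] at hv
      have : ordF v (x.1 j) = 0 := congrFun (congrArg Prod.fst hv) j
      simp [this]
  · have hw0 : 0 < w (x.1 j : F) := (InfinitePlace.pos_iff).2 (x.1 j).ne_zero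
    refine le_pow_of_rpow_le hc hw0.le hB (le_trans ?_ hHIB)
    -- A single factor is at most the product because the others are at least `1`.
    have hle : S.localHeightInf w t (x.map (algebraMap F w.Completion)) ≤ HI := by
      rw [hHI, ← Finset.mul_prod_erase _ _ (Finset.mem_univ w)]
      exact le_mul_of_one_le_right (zero_le_one.trans (hloc1 w))
        (Finset.one_le_prod fun w _ => hloc1 w)
    refine le_trans ?_ hle
    rw [Real.rpow_def_of_pos hw0]
    refine Real.exp_le_exp.2 ?_
    have h1 := hinf (logInf w (x.map (algebraMap F w.Completion))) j
    rw [logInf_map, abs_neg] at h1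
    have h2 : (1 : ℝ) ≤ w.mult := InfinitePlace.one_le_mult
    have h3 := le_mul_of_one_le_left (hpinf (logInf w (x.map (algebraMap F w.Completion)))) h2
    have h4 := mul_le_mul_of_nonneg_left (le_abs_self (Real.log (w (x.1 j : F)))) hc.le
    linarith
  · refine le_pow_of_rpow_le hc (Nat.cast_nonneg _) hB ((natCast_finprod_rpow_le hS x
      (fun v => if ordMod (ℓ i) v (x.2 i) = 0 then 1 else Ideal.absNorm v.asIdeal) (fun v => ?_)
      (fun v hv => ?_)).trans hHFB)
    · split_ifs with h0
      · simpa using one_le_localHeightFin hφ v _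
      · rw [Real.rpow_def_of_pos (hNpos v)]
        -- A nonzero residue makes the whole cocharacter nonzero, so `φ_t ≥ c` applies even when its
        -- rigid part vanishes.
        refine Real.exp_le_exp.2 (mul_le_mul_of_nonneg_left (hy0 _ fun hv => h0 ?_) (hlogN v).le)
        rw [logFin_map] at hv
        exact congrFun (congrArg Prod.snd hv) i
    · rw [logFin_map] at hv
      exact if_pos (congrFun (congrArg Prod.snd hv) i)

end StackyFan

end ToricStack

theorem mainTheorem4 {F : Type*} [Field F] [NumberField F]
    {N : Type*} [AddCommGroup N] {d k : ℕ} {ℓ : Fin k → ℕ} (hℓ : ∀ i, 0 < ℓ i)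
    (e : N ≃+ ToricStack.Cochar d ℓ)
    (S : ToricStack.StackyFan e) (hS : S.IsComplete)
    (t : S.Param) (ht : t ∈ S.LamInt) :
    ∃ P : Polynomial ℝ, ∀ B : ℝ, 0 ≤ B →
      {x : ToricStack.TorusPoints d ℓ F | S.height t x ≤ B}.Finite ∧
      ({x : ToricStack.TorusPoints d ℓ F | S.height t x ≤ B}.ncard : ℝ) ≤ P.eval B :=
  (ToricStack.StackyFan.polyBounded_height hℓ hS ht).exists_polynomial
    fun _ _ hBB' _ hx => le_trans hx hBB'
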